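/- There is a polynomial-time many-one reduction of the 3-SAT problem to the synthesis problem of two-player Petri games, and it can be chosen such that every formula $F$ is mapped to (a Petri game isomorphic to) the game $G_F$ described below. **Petri games.** A *Petri net* has places $\mathcal P$, transitions $\mathcal T$, a finite nonempty preset $\mathit{pre}(t)\subseteq\mathcal P$ and a finite postset $\mathit{post}(t)\subseteq\mathcal P$ for each $t\in\mathcal T$, and an initial marking $\mathit{In}\subseteq\mathcal P$. Markings are multisets of places; $t$ is enabled at $M$ if $\mathit{pre}(t)\subseteq M$, and firing it yields $M-\mathit{pre}(t)+\mathit{post}(t)$. The net is *safe* if no reachable marking has two tokens on one place. Write $x\le y$ if there is a (possibly empty) directed path from node $x$ to node $y$; $x,y$ are *in conflict* if there are transitions $t_1\ne t_2$ with $\mathit{pre}(t_1)\cap\mathit{pre}(t_2)\neq\emptyset$, $t_1\le x$, $t_2\le y$; they are *concurrent* if neither $x\le y$ nor $y\le x$ holds and they are not in conflict. An *occurrence net* is an acyclic net in which every node has finitely many predecessors, every place has at most one incoming transition, no transition is in conflict with itself, and $\mathit{In}$ is the set of places without incoming transitions. A *branching process* of a net $N_0$ is an occurrence net $N$ with a map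 $\pi$ of places to places and transitions to transitions of $N_0$ that restricts to bijections $\mathit{pre}(t)\to\mathit{pre}_0(\pi(t))$, $\mathit{post}(t)\to\mathit{post}_0(\pi(t))$ and $\mathit{In}\to\mathit{In}_0$, and such that $\mathit{pre}(t_1)=\mathit{pre}(t_2)$ and $\pi(t_1)=\pi(t_2)$ imply $t_1=t_2$. A *Petri game* is a finite safe Petri net $N_0$ whose places are partitioned into system places and environment places, with a set $\mathcal B\subseteq 2^{\mathcal P_0}$ of bad markings. A *winning strategy* is a branching process $(N,\pi)$ of $N_0$ such that: 1. (justified refusal) if $C$ is a set of pairwise concurrent places of $N$ and $t\in\mathcal T_0$ satisfies $\pi(C)=\mathit{pre}_0(t)$, but no transition $t'$ of $N$ has $\pi(t')=t$ and $\mathit{pre}(t')=C$, then some $p\in C$ with $\pi(p)$ a system place satisfies $t\notin\pi(\mathit{post}(p))$; 2. (safety) $\pi(M)\notin\mathcal B$ for every reachable marking $M$ of $N$; 3. (determinism) if $\pi(p)$ is a system place and $p\in M$ for a reachable marking $M$ of $N$, then at most one transition in $\mathit{post}(p)$ is enabled at $M$; 4. (deadlock avoidance) if $M$ is a reachable marking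 of $N$ and some transition of $N_0$ is enabled at $\pi(M)$, then some transition of $N$ is enabled at $M$. A Petri game is a *two-player* game if every reachable marking has at most two tokens. The *synthesis problem* asks whether a given Petri game has a winning strategy. **3-SAT.** An instance $F$ consists of variables $x_1,\dots,x_m$ and a conjunction of clauses $(\ell^i_1\vee\ell^i_2\vee\ell^i_3)$, $i=1,\dots,n$, each $\ell^i_j$ being a variable $x_k$ or its negation $\bar x_k$; the question is whether $F$ is satisfiable. **Reduction.** The reduction is a function from 3-SAT instances to two-player Petri games, computed by a Turing machine in a number of steps polynomial in the input length, such that $F$ is satisfiable if and only if the Petri game has a winning strategy. A formula is written as the list of its variables followed by the list of its literals, clause by clause; a Petri game is written as its number of places, its initial marking, its system places, the presets and postsets of its transitions, and its bad markings. Variable indices and place numbers are written in unary (the word for $F$ has length at most $(m+1)(3n+1)$). **The game $G_F$.** It has the places $s_0,\dots,s_m$; $x_k,\bar x_k$ ($1\le k\le m$); $c_0,\dots,c_n$; and $x^i_j$ ($1\le i\le n$, $j=1,2,3$). All of them are system places, and the initial marking is $\{s_0,c_0\}$. Every transition moves one token: $s_{k-1}\to x_k$, $s_{k-1}\to\bar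 x_k$, $x_k\to s_k$, $\bar x_k\to s_k$ for $1\le k\le m$ (one system player chooses a truth value for each variable in sequence), and $c_{i-1}\to x^i_j$, $x^i_j\to c_i$ for $1\le i\le n$, $j=1,2,3$ (the other system player chooses one literal of each clause). The bad markings are the sets $\{x_k,x^i_j\}$ with $\ell^i_j=\bar x_k$ and the sets $\{\bar x_k,x^i_j\}$ with $\ell^i_j=x_k$. -/

import Mathlib

/-! ## Petri nets -/

/-- A Petri net with places `P` and transitions `T` (separate types, hence disjoint). The initial
marking is a finite set of places; all nets below that occur in games and strategies are of this
kind. -/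
structure PetriNet (P T : Type) where
  pre : T → Finset P
  post : T → Finset P
  init : Finset P
  pre_nonempty : ∀ t, (pre t).Nonempty

namespace PetriNet

variable {P T : Type} (N : PetriNet P T)

/-- The transition `t` is enabled at the marking `M` (a multiset of places). -/
def Enabled (M : Multiset P) (t : T) : Prop :=
  (N.pre t).val ≤ M

open Classical in
/-- `M |t⟩ M'`: firing the enabled transition `t` at `M` yields `M' = M - pre t + post t`. -/
def Fires (M : Multiset P) (t : T) (M' : Multiset P) : Prop :=
  N.Enabled M t ∧ M' = M - (N.pre t).val + (N.post t).val

/-- Markings reachable from the initial marking by a finite (possibly empty) firing sequence. -/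
def Reachable (M : Multiset P) : Prop :=
  Relation.ReflTransGen (fun M₁ M₂ => ∃ t, N.Fires M₁ t M₂) N.init.val M

/-- Every reachable marking carries at most one token on each place. -/
def Safe : Prop :=
  ∀ M, N.Reachable M → M.Nodup

/-- The flow relation on the nodes (places and transitions) of a net. -/
def Flow : P ⊕ T → P ⊕ T → Prop
  | .inl p, .inr t => p ∈ N.pre t
  | .inr t, .inl p => p ∈ N.post t
  | _, _ => False

/-- `x` is a causal predecessor of `y` (or equal to it). -/
def CausalLE (x y : P ⊕ T) : Prop :=
  Relation.ReflTransGen N.Flow x y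

/-- The nodes `x` and `y` are in conflict. -/
def Conflict (x y : P ⊕ T) : Prop :=
  ∃ t₁ t₂ : T, t₁ ≠ t₂ ∧ (∃ p, p ∈ N.pre t₁ ∧ p ∈ N.pre t₂) ∧
    N.CausalLE (.inr t₁) x ∧ N.CausalLE (.inr t₂) y

/-- The nodes `x` and `y` are neither causally related nor in conflict. -/
def Concurrent (x y : P ⊕ T) : Prop :=
  ¬ N.CausalLE x y ∧ ¬ N.CausalLE y x ∧ ¬ N.Conflict x y

/-- Occurrence nets. -/
structure IsOccurrenceNet : Prop where
  acyclic : ∀ x, ¬ Relation.TransGen N.Flow x x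
  finitely_preceded : ∀ x, {y | N.CausalLE y x}.Finite
  /-- a place has at most one incoming transition -/
  pre_place_unique : ∀ p t t', p ∈ N.post t → p ∈ N.post t' → t = t'
  no_self_conflict : ∀ t, ¬ N.Conflict (.inr t) (.inr t)
  /-- the initial marking consists of the places with empty preset -/
  mem_init_iff : ∀ p, p ∈ N.init ↔ ∀ t, p ∉ N.post t

/-- Homomorphisms of Petri nets, given by their restrictions to places and to transitions. -/
structure Hom {P₁ T₁ P₂ T₂ : Type} (N₁ : PetriNet P₁ T₁) (N₂ : PetriNet P₂ T₂) where
  place : P₁ → P₂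
  trans : T₁ → T₂
  bijOn_pre : ∀ t, Set.BijOn place (N₁.pre t) (N₂.pre (trans t))
  bijOn_post : ∀ t, Set.BijOn place (N₁.post t) (N₂.post (trans t))
  bijOn_init : Set.BijOn place N₁.init N₂.init

end PetriNet

/-- A (possibly infinite) branching process of the net `N₀`. -/
structure BranchingProcess {P₀ T₀ : Type} (N₀ : PetriNet P₀ T₀) where
  Place : Type
  Trans : Type
  net : PetriNet Place Trans
  isOccurrenceNet : net.IsOccurrenceNet
  hom : PetriNet.Hom net N₀
  trans_unique : ∀ t₁ t₂, net.pre t₁ = net.pre t₂ → hom.trans t₁ = hom.trans t₂ → t₁ = t₂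

/-! ## Petri games -/

/-- A Petri game on a finite and safe Petri net. The environment places are the places that are
not system places. -/
structure PetriGame (P T : Type) where
  net : PetriNet P T
  finite_places : Finite P
  finite_transitions : Finite T
  safe : net.Safe
  system : Set P
  /-- the set of bad markings -/
  bad : Set (Finset P)

namespace PetriGame

variable {P T P' T' : Type}

/-- The branching process `σ` is a winning strategy of the game `G`. -/
structure IsWinningStrategy (G : PetriGame P T) (σ : BranchingProcess G.net) : Prop where
  justified_refusal : ∀ (C : Set σ.Place) (t : T),
    (C.Pairwise fun p q => σ.net.Concurrent (.inl p) (.inl q)) →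
    σ.hom.place '' C = G.net.pre t →
    (¬ ∃ t', σ.hom.trans t' = t ∧ (σ.net.pre t' : Set σ.Place) = C) →
    ∃ p ∈ C, σ.hom.place p ∈ G.system ∧ ∀ t', p ∈ σ.net.pre t' → σ.hom.trans t' ≠ t
  safety : ∀ M, σ.net.Reachable M → ∀ B ∈ G.bad, M.map σ.hom.place ≠ B.val
  determinism : ∀ p, σ.hom.place p ∈ G.system → ∀ M, σ.net.Reachable M → p ∈ M →
    ∀ t t', p ∈ σ.net.pre t → p ∈ σ.net.pre t' →
      σ.net.Enabled M t → σ.net.Enabled M t' → t = t'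
  deadlock_avoiding : ∀ M, σ.net.Reachable M →
    (∃ t, G.net.Enabled (M.map σ.hom.place) t) → ∃ t, σ.net.Enabled M t

/-- The question of the synthesis problem. -/
def HasWinningStrategy (G : PetriGame P T) : Prop :=
  ∃ σ : BranchingProcess G.net, G.IsWinningStrategy σ

/-- `G` is a `K`-player Petri game: no reachable marking has more than `K` tokens. -/
def IsKPlayer (G : PetriGame P T) (K : ℕ) : Prop :=
  ∀ M, G.net.Reachable M → M.card ≤ K

/-- Isomorphisms of Petri games (renamings of places and transitions). -/
structure Iso (G : PetriGame P T) (G' : PetriGame P' T') where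
  place : P ≃ P'
  trans : T ≃ T'
  map_pre : ∀ t, (G.net.pre t).map place.toEmbedding = G'.net.pre (trans t)
  map_post : ∀ t, (G.net.post t).map place.toEmbedding = G'.net.post (trans t)
  map_init : G.net.init.map place.toEmbedding = G'.net.init
  system_iff : ∀ p, p ∈ G.system ↔ place p ∈ G'.system
  bad_iff : ∀ B : Finset P, B ∈ G.bad ↔ B.map place.toEmbedding ∈ G'.bad

end PetriGame

/-! ## Petri games as finite data -/

/-- A finite Petri net as finite data: the places are `0, …, numPlaces - 1`, each transition is
given by listing its preset and its postset, and finite sets are given by lists. -/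
structure NetPresentation where
  numPlaces : ℕ
  transitions : List (List (Fin numPlaces) × List (Fin numPlaces))
  init : List (Fin numPlaces)
  pre_ne_nil : ∀ t ∈ transitions, t.1 ≠ []

/-- The Petri net that is presented. -/
def NetPresentation.net (D : NetPresentation) :
    PetriNet (Fin D.numPlaces) (Fin D.transitions.length) where
  pre t := (D.transitions.get t).1.toFinset
  post t := (D.transitions.get t).2.toFinset
  init := D.init.toFinset
  pre_nonempty t := by
    rw [List.toFinset_nonempty_iff]
    exact D.pre_ne_nil _ (List.get_mem _ _)

/-- A Petri game as finite data. -/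
structure GamePresentation extends NetPresentation where
  safe : toNetPresentation.net.Safe
  system : List (Fin numPlaces)
  bad : List (List (Fin numPlaces))

/-- The Petri game that is presented. -/
def GamePresentation.game (D : GamePresentation) :
    PetriGame (Fin D.numPlaces) (Fin D.transitions.length) where
  net := D.toNetPresentation.net
  finite_places := inferInstance
  finite_transitions := inferInstance
  safe := D.safe
  system := {p | p ∈ D.system}
  bad := {B | ∃ l ∈ D.bad, B = l.toFinset}

/-- The tape alphabet for Petri games. -/
inductive GameSymbol
  | tick
  | endPlace
  | endSet
  | endBlock
  deriving DecidableEq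

instance : Fintype GameSymbol :=
  ⟨{.tick, .endPlace, .endSet, .endBlock}, fun x => by cases x <;> simp⟩

namespace GamePresentation

/-- The number `k` in unary, with an end marker. -/
def encodeNumber (k : ℕ) : List GameSymbol :=
  List.replicate k .tick ++ [.endPlace]

/-- A list of places, with an end marker. -/
def encodeSet {n : ℕ} (l : List (Fin n)) : List GameSymbol :=
  l.flatMap (fun p => encodeNumber p.val) ++ [.endSet]

/-- The word that describes a Petri game: number of places, initial marking, system places,
transitions, bad markings. -/
def encode (D : GamePresentation) : List GameSymbol :=
  encodeNumber D.numPlaces ++ encodeSet D.init ++ encodeSet D.system ++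
    D.transitions.flatMap (fun t => encodeSet t.1 ++ encodeSet t.2) ++ [.endBlock] ++
    D.bad.flatMap encodeSet ++ [.endBlock]

theorem encodeNumber_append_inj {k k' : ℕ} {r r' : List GameSymbol}
    (h : encodeNumber k ++ r = encodeNumber k' ++ r') : k = k' ∧ r = r' := by
  induction k generalizing k' with
  | zero => cases k' <;> simp_all [encodeNumber, List.replicate_succ]
  | succ k ih =>
    cases k' with
    | zero => simp [encodeNumber, List.replicate_succ] at h
    | succ k' =>
      have := @ih k' (by simpa [encodeNumber, List.replicate_succ] using h)
      simpa using this

theorem encodeNumber_head? (k : ℕ) (r : List GameSymbol) :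
    (encodeNumber k ++ r).head? = some .tick ∨ (encodeNumber k ++ r).head? = some .endPlace := by
  cases k <;> simp [encodeNumber, List.replicate_succ]

theorem encodeSet_append_inj {n : ℕ} {l l' : List (Fin n)} {r r' : List GameSymbol}
    (h : encodeSet l ++ r = encodeSet l' ++ r') : l = l' ∧ r = r' := by
  induction l generalizing l' with
  | nil =>
    cases l' with
    | nil => simpa [encodeSet] using h
    | cons p l' =>
      have h2 := encodeNumber_head? p (encodeSet l' ++ r')
      have h3 : encodeNumber p ++ (encodeSet l' ++ r') = .endSet :: r := by
        simpa [encodeSet] using h.symm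
      rw [h3] at h2
      simp at h2
  | cons p l ih =>
    cases l' with
    | nil =>
      have h2 := encodeNumber_head? p (encodeSet l ++ r)
      have h3 : encodeNumber p ++ (encodeSet l ++ r) = .endSet :: r' := by
        simpa [encodeSet] using h
      rw [h3] at h2
      simp at h2
    | cons p' l' =>
      have h2 := @encodeNumber_append_inj p p' (encodeSet l ++ r) (encodeSet l' ++ r')
        (by simpa [encodeSet] using h)
      have h3 := ih h2.2
      simp [Fin.ext h2.1, h3.1, h3.2]

theorem encodeSet_head? {n : ℕ} (l : List (Fin n)) (r : List GameSymbol) :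
    (encodeSet l ++ r).head? ≠ some .endBlock := by
  cases l with
  | nil => simp [encodeSet]
  | cons p l =>
    have h2 := encodeNumber_head? p (encodeSet l ++ r)
    intro h
    have h3 : encodeNumber p ++ (encodeSet l ++ r) = encodeSet (p :: l) ++ r := by
      simp [encodeSet]
    rw [h3, h] at h2
    simp at h2

theorem encodeBlock_append_inj {α : Type} (e : α → List GameSymbol)
    (he : ∀ a b r r', e a ++ r = e b ++ r' → a = b ∧ r = r')
    (he' : ∀ a r, (e a ++ r).head? ≠ some .endBlock) {l l' : List α} {r r' : List GameSymbol}
    (h : l.flatMap e ++ [.endBlock] ++ r = l'.flatMap e ++ [.endBlock] ++ r') :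
    l = l' ∧ r = r' := by
  induction l generalizing l' with
  | nil =>
    cases l' with
    | nil => simpa using h
    | cons p l' =>
      have h2 := congrArg List.head? h
      have := he' p (l'.flatMap e ++ [.endBlock] ++ r')
      simp only [List.flatMap_cons, List.append_assoc] at h2 this
      exact absurd h2.symm this
  | cons p l ih =>
    cases l' with
    | nil =>
      have h2 := congrArg List.head? h
      have := he' p (l.flatMap e ++ [.endBlock] ++ r)
      simp only [List.flatMap_cons, List.append_assoc] at h2 this
      exact absurd h2 this
    | cons p' l' =>
      have h2 := he p p' (l.flatMap e ++ [.endBlock] ++ r) (l'.flatMap e ++ [.endBlock] ++ r')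
        (by simpa using h)
      have h3 := ih h2.2
      simp [h2.1, h3.1, h3.2]

/-- Different presentations are described by different words. -/
theorem encode_injective : Function.Injective encode := by
  rintro ⟨⟨n, ts, i, h1⟩, h2, s, b⟩ ⟨⟨n', ts', i', h1'⟩, h2', s', b'⟩ h
  simp only [encode, List.append_assoc] at h
  obtain ⟨rfl, h3⟩ := encodeNumber_append_inj h
  obtain ⟨rfl, h4⟩ := encodeSet_append_inj h3
  obtain ⟨rfl, h5⟩ := encodeSet_append_inj h4
  obtain ⟨rfl, h6⟩ := encodeBlock_append_inj
    (fun t : List (Fin n) × List (Fin n) => encodeSet t.1 ++ encodeSet t.2)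
    (fun t t' r r' h => by
      obtain ⟨h1, h⟩ := encodeSet_append_inj (by simpa using h)
      obtain ⟨h2, h⟩ := encodeSet_append_inj h
      exact ⟨Prod.ext h1 h2, h⟩)
    (fun t r => by
      simpa only [List.append_assoc] using encodeSet_head? t.1 (encodeSet t.2 ++ r))
    (by simpa only [List.append_assoc] using h5)
  obtain ⟨rfl, -⟩ := encodeBlock_append_inj encodeSet
    (fun _ _ _ _ h => encodeSet_append_inj h) encodeSet_head? (r := []) (r' := [])
    (by simpa using h6)
  rfl

end GamePresentation

/-- Two-player Petri games, the instances of the synthesis problem of two-player Petri games. -/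
def TwoPlayerPetriGame : Type :=
  {D : GamePresentation // D.game.IsKPlayer 2}

/-- The word that describes a two-player Petri game. -/
def TwoPlayerPetriGame.encode (D : TwoPlayerPetriGame) : List GameSymbol :=
  D.1.encode

/-- The Petri game that is presented. -/
def TwoPlayerPetriGame.game (D : TwoPlayerPetriGame) :
    PetriGame (Fin D.1.numPlaces) (Fin D.1.transitions.length) :=
  D.1.game

/-- The synthesis problem of two-player Petri games: the set of its yes-instances. -/
def TwoPlayerSynthesis : Set TwoPlayerPetriGame :=
  {D | D.game.HasWinningStrategy}

/-! ## 3-SAT -/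

/-- A formula in conjunctive normal form over the variables `x_0, …, x_{numVars - 1}` all of whose
clauses have exactly three literals. The literal `(k, true)` is `x_k`, and `(k, false)` is its
negation. -/
structure ThreeCNF where
  numVars : ℕ
  clauses : List (Fin 3 → Fin numVars × Bool)

/-- The tape alphabet for formulas. -/
inductive FormulaSymbol
  | tick
  | endVars
  | pos
  | neg
  deriving DecidableEq

instance : Fintype FormulaSymbol :=
  ⟨{.tick, .endVars, .pos, .neg}, fun x => by cases x <;> simp⟩

namespace ThreeCNF

/-- Some assignment makes at least one literal of every clause true. -/
def Satisfiable (F : ThreeCNF) : Prop :=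
  ∃ v : Fin F.numVars → Bool, ∀ c ∈ F.clauses, ∃ j, v (c j).1 = (c j).2

/-- The index of the variable in unary, followed by the sign. -/
def encodeLiteral {m : ℕ} (l : Fin m × Bool) : List FormulaSymbol :=
  List.replicate l.1 .tick ++ [if l.2 then .pos else .neg]

/-- The word that describes a formula: one tick for each variable, then the literals of the
clauses in their order. -/
def encode (F : ThreeCNF) : List FormulaSymbol :=
  List.replicate F.numVars .tick ++ [.endVars] ++
    F.clauses.flatMap (fun c => encodeLiteral (c 0) ++ encodeLiteral (c 1) ++ encodeLiteral (c 2))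

theorem encodeLiteral_append_inj {m : ℕ} {l l' : Fin m × Bool} {r r' : List FormulaSymbol}
    (h : encodeLiteral l ++ r = encodeLiteral l' ++ r') : l = l' ∧ r = r' := by
  obtain ⟨⟨k, hk⟩, b⟩ := l
  obtain ⟨⟨k', hk'⟩, b'⟩ := l'
  have key : ∀ k k', List.replicate k FormulaSymbol.tick ++ [if b then .pos else .neg] ++ r =
      List.replicate k' FormulaSymbol.tick ++ [if b' then .pos else .neg] ++ r' →
      k = k' ∧ b = b' ∧ r = r' := by
    intro k
    induction k with
    | zero =>
      intro k' h
      cases k' <;> cases b <;> cases b' <;> simp_all [List.replicate_succ]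
    | succ k ih =>
      intro k' h
      cases k' with
      | zero => cases b <;> cases b' <;> simp [List.replicate_succ] at h
      | succ k' => simpa using ih k' (by simpa [List.replicate_succ] using h)
  obtain ⟨rfl, rfl, rfl⟩ := key k k' h
  exact ⟨rfl, rfl⟩

/-- Different formulas are described by different words. -/
theorem encode_injective : Function.Injective encode := by
  rintro ⟨m, cs⟩ ⟨m', cs'⟩ h
  have hm : m = m' := by
    simp only [encode, List.append_assoc] at h
    generalize List.flatMap _ cs = r at h
    generalize List.flatMap _ cs' = r' at h
    clear cs cs'
    induction m generalizing m' with
    | zero => cases m' <;> simp_all [List.replicate_succ]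
    | succ m ih =>
      cases m' with
      | zero => simp [List.replicate_succ] at h
      | succ m' => simpa using ih m' (by simpa [List.replicate_succ] using h)
  subst hm
  simp only [encode, List.append_cancel_left_eq] at h
  congr 1
  induction cs generalizing cs' with
  | nil =>
    cases cs' with
    | nil => rfl
    | cons c cs' => simp [encodeLiteral] at h
  | cons c cs ih =>
    cases cs' with
    | nil => simp [encodeLiteral] at h
    | cons c' cs' =>
      simp only [List.flatMap_cons, List.append_assoc] at h
      obtain ⟨h0, h⟩ := encodeLiteral_append_inj h
      obtain ⟨h1, h⟩ := encodeLiteral_append_inj h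
      obtain ⟨h2, h⟩ := encodeLiteral_append_inj h
      have hc : c = c' := by
        funext j
        fin_cases j
        exacts [h0, h1, h2]
      rw [hc, ih cs' (by simpa only [List.append_assoc] using h)]

/-- Writing numbers in unary does not blow up formulas: the length of the word is polynomial in
the number of variables and the number of clauses. -/
theorem length_encode_le (F : ThreeCNF) :
    F.encode.length ≤ (F.numVars + 1) * (3 * F.clauses.length + 1) := by
  obtain ⟨m, cs⟩ := F
  have key : ∀ cs : List (Fin 3 → Fin m × Bool), (cs.flatMap (fun c => encodeLiteral (c 0) ++
      encodeLiteral (c 1) ++ encodeLiteral (c 2))).length ≤ m * (3 * cs.length) := by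
    intro cs
    induction cs with
    | nil => simp
    | cons c cs ih =>
      have h0 := (c 0).1.2
      have h1 := (c 1).1.2
      have h2 := (c 2).1.2
      simp only [List.flatMap_cons, List.length_append, List.length_cons, encodeLiteral,
        List.length_replicate, List.length_nil] at ih ⊢
      nlinarith
  have := key cs
  simp only [encode, List.length_append, List.length_replicate, List.length_cons,
    List.length_nil]
  nlinarith

end ThreeCNF

/-- The 3-SAT problem: the set of its yes-instances. -/
def ThreeSAT : Set ThreeCNF :=
  {F | F.Satisfiable}

/-! ## Polynomial-time reductions -/

/-- `f` is a polynomial-time (many-one) reduction of the problem `A` to the problem `B`: a Turing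
machine computes `f` on encoded instances in a number of steps that is polynomial in the length
of the input, and `f` preserves and reflects yes-instances. -/
def IsPolyTimeReduction {α β Γα Γβ : Type} (encα : α → List Γα) (encβ : β → List Γβ)
    (A : Set α) (B : Set β) (f : α → β) : Prop :=
  Nonempty (Turing.TM2ComputableInPolyTime encα encβ f) ∧ ∀ a, a ∈ A ↔ f a ∈ B

/-! ## The Petri game of a formula -/

namespace ThreeCNF

variable (F : ThreeCNF)

/-- Places of the Petri game of a formula with `m` variables and `n` clauses: the first player
moves on `stage` and `value`, the second one on `clauseStage` and `literal`. -/
inductive Place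
  /-- the values of the first `k` variables have been chosen -/
  | stage (k : Fin (F.numVars + 1))
  /-- the value of the variable `k` is chosen to be `b` -/
  | value (k : Fin F.numVars) (b : Bool)
  /-- literals of the first `i` clauses have been chosen -/
  | clauseStage (i : Fin (F.clauses.length + 1))
  /-- the literal with number `j` of the clause `i` is chosen -/
  | literal (i : Fin F.clauses.length) (j : Fin 3)
  deriving DecidableEq, Fintype

/-- Transitions of the Petri game of a formula. -/
inductive Trans
  | choose (k : Fin F.numVars) (b : Bool)
  | advance (k : Fin F.numVars) (b : Bool)
  | pick (i : Fin F.clauses.length) (j : Fin 3)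
  | proceed (i : Fin F.clauses.length) (j : Fin 3)
  deriving DecidableEq, Fintype

/-- The unique place in the preset of a transition. -/
def source : F.Trans → F.Place
  | .choose k _ => .stage k.castSucc
  | .advance k b => .value k b
  | .pick i _ => .clauseStage i.castSucc
  | .proceed i j => .literal i j

/-- The unique place in the postset of a transition. -/
def target : F.Trans → F.Place
  | .choose k b => .value k b
  | .advance k _ => .stage k.succ
  | .pick i j => .literal i j
  | .proceed i _ => .clauseStage i.succ

/-- The Petri net of the formula `F`. -/
def net : PetriNet F.Place F.Trans where
  pre t := {F.source t}
  post t := {F.target t}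
  init := {.stage 0, .clauseStage 0}
  pre_nonempty _ := Finset.singleton_nonempty _

/-- The place belongs to the first player, who chooses the truth values. -/
def isFirst : F.Place → Bool
  | .stage _ => true
  | .value _ _ => true
  | .clauseStage _ => false
  | .literal _ _ => false

theorem isFirst_target (t : F.Trans) : F.isFirst (F.target t) = F.isFirst (F.source t) := by
  cases t <;> rfl

/-- Each reachable marking of the net of a formula consists of one place of each player. -/
theorem reachable_net {M : Multiset F.Place} (h : F.net.Reachable M) :
    ∃ p q, F.isFirst p = true ∧ F.isFirst q = false ∧ M = {p, q} := by
  classical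
  induction h with
  | refl => exact ⟨.stage 0, .clauseStage 0, rfl, rfl, rfl⟩
  | tail _ h ih =>
    obtain ⟨p, q, hp, hq, rfl⟩ := ih
    obtain ⟨t, he, rfl⟩ := h
    have ht := F.isFirst_target t
    simp only [PetriNet.Enabled, net, Finset.singleton_val, Multiset.singleton_le,
      Multiset.insert_eq_cons, Multiset.mem_cons, Multiset.mem_singleton] at he
    rcases he with he | he
    · refine ⟨F.target t, q, by rw [ht, he, hp], hq, ?_⟩
      simp only [net, Finset.singleton_val, he, Multiset.sub_singleton, Multiset.insert_eq_cons,
        Multiset.erase_cons_head]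
      exact Multiset.pair_comm _ _
    · refine ⟨p, F.target t, hp, by rw [ht, he, hq], ?_⟩
      rw [show ({p, q} : Multiset F.Place) = q ::ₘ {p} from Multiset.pair_comm p q]
      simp only [net, Finset.singleton_val, he, Multiset.sub_singleton, Multiset.insert_eq_cons,
        Multiset.erase_cons_head]
      rfl

theorem safe_net : F.net.Safe := by
  intro M h
  obtain ⟨p, q, hp, hq, rfl⟩ := F.reachable_net h
  have hpq : p ≠ q := by
    rintro rfl
    simp [hp] at hq
  simp [Multiset.insert_eq_cons, hpq]

/-- The Petri game of the formula `F`. All places are system places, and the bad markings consist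
of a value of a variable and a chosen literal that is false under this value. -/
def game : PetriGame F.Place F.Trans where
  net := F.net
  finite_places := inferInstance
  finite_transitions := inferInstance
  safe := F.safe_net
  system := Set.univ
  bad := {B | ∃ k b i j, (F.clauses.get i) j = (k, !b) ∧ B = {.value k b, .literal i j}}

end ThreeCNF

/-!
The reduction sends a formula to its Petri game with numbered places and transitions.

*Correctness.* A place of the game of a formula belongs to one of two players who never
synchronize, so every place that one player can reach in a strategy occurs in a reachable marking
together with every place that the other one can reach (`ThreeCNF.reachable_pair`). Transitions
increase the numbers of places, hence each player of a strategy eventually gets stuck; the two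
stuck places form a reachable marking, and deadlock avoidance forces them to be the last places of
the players. On the way there the first player has passed through a value of every variable and the
second one through a literal of every clause. By safety these literals are true under these values
(`ThreeCNF.satisfiable_of_hasWinningStrategy`). Conversely, a satisfying assignment and a choice of
a true literal in every clause single out one path for each player, and these two paths form a
winning strategy (`ThreeCNF.isWinningStrategy_play`).

*Complexity.* Programs built from pushing, branching and looping over stacks are compiled to Turing
machines with the same number of steps (`StackProgram.Exec.iterate_step`). The game is written by
such a program, `GameWriter.gameWriter`, whose stacks hold the input, the output and unary counters.
With `m` variables and `n` clauses, the places are numbered in the order of the paths: the places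
around the variable `k` are `3 * k, …, 3 * k + 3`, and those around the clause `i` are
`3 * m + 1 + 4 * i, …, 3 * m + 1 + 4 * i + 4`. Therefore every number in the output is a counter plus
a constant. Since the output is a stack, it is written from its end: one pass over the input yields
the bad markings and counts variables and clauses, one pass back over the clauses and variables
yields the transitions, and the system places, the initial marking and the number of places come
last. The number of steps is quadratic in the number of places (`GameWriter.runs_gameWriter`).
-/

/-! ### Isomorphic nets and games -/

namespace PetriNet

variable {P T P' T' : Type}

/-- Firing sequences are transported along a renaming of places and transitions that respects
presets, postsets and the initial marking. -/
theorem Reachable.map {N : PetriNet P T} {N' : PetriNet P' T'} (e : P ≃ P') (τ : T → T')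
    (hpre : ∀ t, (N.pre t).map e.toEmbedding = N'.pre (τ t))
    (hpost : ∀ t, (N.post t).map e.toEmbedding = N'.post (τ t))
    (hinit : N.init.map e.toEmbedding = N'.init) {M : Multiset P} (h : N.Reachable M) :
    N'.Reachable (M.map e) := by
  classical
  induction h with
  | refl =>
    rw [Reachable, ← hinit]
    exact Relation.ReflTransGen.refl
  | tail _ h ih =>
    obtain ⟨t, he, rfl⟩ := h
    obtain ⟨R, rfl⟩ := Multiset.le_iff_exists_add.1 he
    refine Relation.ReflTransGen.tail ih ⟨τ t, ?_, ?_⟩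
    · rw [Enabled, ← hpre]
      exact Multiset.map_le_map he
    -- The marking is the preset of `t` plus a rest `R`, so the subtraction leaves exactly `R`.
    · rw [← hpre, ← hpost, Multiset.map_add, Finset.map_val, Finset.map_val, Multiset.map_add]
      simp only [Equiv.coe_toEmbedding]
      rw [add_tsub_cancel_left, add_tsub_cancel_left]

end PetriNet

namespace PetriGame

variable {P T P' T' : Type} {G : PetriGame P T} {G' : PetriGame P' T'}

/-- The inverse of an isomorphism of Petri games. -/
def Iso.symm (e : G.Iso G') : G'.Iso G where
  place := e.place.symm
  trans := e.trans.symm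
  map_pre t := by
    obtain ⟨t, rfl⟩ := e.trans.surjective t
    rw [← e.map_pre, Finset.map_map]
    simp
  map_post t := by
    obtain ⟨t, rfl⟩ := e.trans.surjective t
    rw [← e.map_post, Finset.map_map]
    simp
  map_init := by
    rw [← e.map_init, Finset.map_map]
    simp
  system_iff p := by simp [e.system_iff]
  bad_iff B := by
    rw [e.bad_iff, Finset.map_map]
    simp

/-- A strategy remains winning when its labels are renamed along an isomorphism of games. -/
theorem Iso.hasWinningStrategy (e : G.Iso G') (h : G.HasWinningStrategy) :
    G'.HasWinningStrategy := by
  obtain ⟨σ, hσ⟩ := h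
  have image {s : Finset P} {s' : Finset P'} (hs : s.map e.place.toEmbedding = s') :
      Set.BijOn e.place s s' := by
    subst hs
    refine ⟨fun x hx => by simpa using hx, e.place.injective.injOn, fun x hx => by simpa using hx⟩
  let σ' : BranchingProcess G'.net :=
    { Place := σ.Place
      Trans := σ.Trans
      net := σ.net
      isOccurrenceNet := σ.isOccurrenceNet
      hom :=
        { place := e.place ∘ σ.hom.place
          trans := e.trans ∘ σ.hom.trans
          bijOn_pre := fun t => (image (e.map_pre _)).comp (σ.hom.bijOn_pre t)
          bijOn_post := fun t => (image (e.map_post _)).comp (σ.hom.bijOn_post t)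
          bijOn_init := (image e.map_init).comp σ.hom.bijOn_init }
      trans_unique := fun t₁ t₂ h₁ h₂ => σ.trans_unique t₁ t₂ h₁ (e.trans.injective h₂) }
  refine ⟨σ', ?_, ?_, ?_, ?_⟩
  · intro C t hC ht hn
    obtain ⟨s, rfl⟩ := e.trans.surjective t
    have ht' : σ.hom.place '' C = G.net.pre s := by
      rw [← (image (e.map_pre s)).image_eq] at ht
      change (e.place ∘ σ.hom.place) '' C = _ at ht
      rw [Set.image_comp] at ht
      exact e.place.injective.image_injective ht
    obtain ⟨p, hp, hs, hr⟩ := hσ.justified_refusal C s hC ht' (by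
      rintro ⟨t', h, h'⟩
      exact hn ⟨t', congrArg e.trans h, h'⟩)
    exact ⟨p, hp, (e.system_iff _).1 hs, fun t' h h' => hr t' h (e.trans.injective h')⟩
  · intro M hM B hB h
    obtain ⟨B, rfl⟩ : ∃ B' : Finset P, B = B'.map e.place.toEmbedding :=
      ⟨B.map e.place.symm.toEmbedding, by rw [Finset.map_map]; simp⟩
    refine hσ.safety M hM B ((e.bad_iff B).2 hB) ?_
    change M.map (e.place ∘ σ.hom.place) = B.val.map e.place at h
    rw [← Multiset.map_map] at h
    exact Multiset.map_injective e.place.injective h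
  · intro p hp
    exact hσ.determinism p ((e.system_iff _).2 hp)
  · rintro M hM ⟨t, ht⟩
    obtain ⟨t, rfl⟩ := e.trans.surjective t
    refine hσ.deadlock_avoiding M hM ⟨t, ?_⟩
    change (G'.net.pre (e.trans t)).val ≤ M.map (e.place ∘ σ.hom.place) at ht
    rw [← e.map_pre, ← Multiset.map_map] at ht
    exact (Multiset.map_le_map_iff e.place.injective).1 ht

/-- Isomorphic games agree on the existence of a winning strategy. -/
theorem Iso.hasWinningStrategy_iff (e : G.Iso G') :
    G.HasWinningStrategy ↔ G'.HasWinningStrategy :=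
  ⟨e.hasWinningStrategy, e.symm.hasWinningStrategy⟩

end PetriGame

/-! ### Winning strategies and satisfying assignments -/

namespace ThreeCNF

variable (F : ThreeCNF)

/-- The number of a place. The places of the first player come before those of the second one,
and every transition leads to a place with a larger number. -/
def index : F.Place → ℕ
  | .stage k => 3 * k
  | .value k b => 3 * k + if b then 1 else 2
  | .clauseStage i => 3 * F.numVars + 1 + 4 * i
  | .literal i j => 3 * F.numVars + 1 + 4 * i + (j + 1)

theorem index_source_lt_index_target (t : F.Trans) :
    F.index (F.source t) < F.index (F.target t) := by
  rcases t with ⟨k, _ | _⟩ | ⟨k, _ | _⟩ | ⟨i, j⟩ | ⟨i, j⟩ <;>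
    simp [source, target, index] <;> omega

section Backward

variable {F} (σ : BranchingProcess F.net)

/-- A transition of the branching process moves a token from the place `p` to the place `q`. -/
def Moves (p q : σ.Place) : Prop :=
  ∃ t, σ.net.pre t = {p} ∧ σ.net.post t = {q}

theorem exists_eq_singleton_of_bijOn {α β : Type} {f : α → β} {s : Finset α} {b : β}
    (h : Set.BijOn f s ({b} : Finset β)) : ∃ a, s = {a} ∧ f a = b := by
  obtain ⟨a, ha, hab⟩ := h.surjOn (show b ∈ (({b} : Finset β) : Set β) by simp)
  refine ⟨a, Finset.eq_singleton_iff_unique_mem.2 ⟨ha, fun x hx => h.injOn hx ha ?_⟩, hab⟩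
  simpa [hab] using h.mapsTo hx

theorem exists_pre_eq (t : σ.Trans) :
    ∃ p, σ.net.pre t = {p} ∧ σ.hom.place p = F.source (σ.hom.trans t) :=
  exists_eq_singleton_of_bijOn (σ.hom.bijOn_pre t)

theorem exists_post_eq (t : σ.Trans) :
    ∃ p, σ.net.post t = {p} ∧ σ.hom.place p = F.target (σ.hom.trans t) :=
  exists_eq_singleton_of_bijOn (σ.hom.bijOn_post t)

variable {σ}

theorem Moves.exists_trans {p q : σ.Place} (h : Moves σ p q) :
    ∃ t, σ.hom.place p = F.source t ∧ σ.hom.place q = F.target t := by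
  obtain ⟨t, hp, hq⟩ := h
  obtain ⟨p', hp', h₁⟩ := exists_pre_eq σ t
  obtain ⟨q', hq', h₂⟩ := exists_post_eq σ t
  rw [hp', Finset.singleton_inj] at hp
  rw [hq', Finset.singleton_inj] at hq
  subst hp hq
  exact ⟨_, h₁, h₂⟩

/-- The two players move independently, so every combination of a place that the first player can
reach with a place that the second player can reach is a reachable marking. -/
theorem reachable_pair {p₀ q₀ p q : σ.Place} (h : σ.net.Reachable {p₀, q₀})
    (hp : Relation.ReflTransGen (Moves σ) p₀ p) (hq : Relation.ReflTransGen (Moves σ) q₀ q) :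
    σ.net.Reachable {p, q} := by
  classical
  have move : ∀ {p p' q : σ.Place}, σ.net.Reachable {p, q} → Moves σ p p' →
      σ.net.Reachable {p', q} := by
    rintro p p' q h ⟨t, h₁, h₂⟩
    refine Relation.ReflTransGen.tail h ⟨t, ?_, ?_⟩
    · simp [PetriNet.Enabled, h₁]
    · rw [h₁, h₂]
      simp only [Finset.singleton_val, Multiset.insert_eq_cons, Multiset.sub_singleton]
      rw [show (p ::ₘ {q} : Multiset σ.Place).erase p = {q} by
        convert Multiset.erase_cons_head p {q}]
      rw [add_comm]
      rfl
  have h₁ : σ.net.Reachable {p, q₀} := by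
    clear hq
    induction hp with
    | refl => exact h
    | tail _ hm ih => exact move ih hm
  rw [Multiset.pair_comm] at h₁ ⊢
  induction hq with
  | refl => exact h₁
  | tail _ hm ih => exact move ih hm

theorem exists_init_eq (σ : BranchingProcess F.net) :
    ∃ p q, σ.hom.place p = .stage 0 ∧ σ.hom.place q = .clauseStage 0 ∧
      σ.net.Reachable {p, q} := by
  classical
  have h := σ.hom.bijOn_init
  obtain ⟨p, hp, hp'⟩ := h.surjOn (show Place.stage 0 ∈ (F.net.init : Set F.Place) by simp [net])
  obtain ⟨q, hq, hq'⟩ :=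
    h.surjOn (show Place.clauseStage 0 ∈ (F.net.init : Set F.Place) by simp [net])
  have hpq : p ≠ q := by
    rintro rfl
    simp [hp'] at hq'
  have hi : σ.net.init = {p, q} := by
    ext x
    simp only [Finset.mem_insert, Finset.mem_singleton]
    refine ⟨fun hx => ?_, ?_⟩
    · have hx' : σ.hom.place x = .stage 0 ∨ σ.hom.place x = .clauseStage 0 := by
        simpa [net] using h.mapsTo hx
      rcases hx' with hx' | hx'
      · exact .inl (h.injOn hx hp (hx'.trans hp'.symm))
      · exact .inr (h.injOn hx hq (hx'.trans hq'.symm))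
    · rintro (rfl | rfl)
      exacts [hp, hq]
  refine ⟨p, q, hp', hq', ?_⟩
  have hv : σ.net.init.val = {p, q} := by
    rw [hi, Finset.insert_val, Multiset.ndinsert_of_notMem (by simpa using hpq)]
    rfl
  rw [← hv]
  exact Relation.ReflTransGen.refl

/-- Since moves increase the numbers of places, a player who keeps moving gets stuck. -/
theorem exists_stuck (p₀ : σ.Place) :
    ∃ p, Relation.ReflTransGen (Moves σ) p₀ p ∧ ∀ q, ¬ Moves σ p q := by
  have : Finite F.Place := inferInstance
  obtain ⟨_, ⟨p, hp, rfl⟩, hmax⟩ := Set.exists_max_image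
    (σ.hom.place '' {p | Relation.ReflTransGen (Moves σ) p₀ p}) F.index (Set.toFinite _)
    ⟨_, p₀, Relation.ReflTransGen.refl, rfl⟩
  refine ⟨p, hp, fun q hq => ?_⟩
  obtain ⟨t, h₁, h₂⟩ := hq.exists_trans
  have := hmax _ ⟨q, hp.tail hq, rfl⟩
  have := F.index_source_lt_index_target t
  rw [h₁, h₂] at *
  omega

theorem isFirst_place {p q : σ.Place} (h : Relation.ReflTransGen (Moves σ) p q) :
    F.isFirst (σ.hom.place q) = F.isFirst (σ.hom.place p) := by
  induction h with
  | refl => rfl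
  | tail _ hm ih =>
    obtain ⟨t, h₁, h₂⟩ := hm.exists_trans
    rw [h₂, F.isFirst_target, ← h₁, ih]

/-- A player who gets beyond a variable has passed through one of the values of the variable. -/
theorem exists_value {p₀ p : σ.Place} (h₀ : σ.hom.place p₀ = .stage 0)
    (h : Relation.ReflTransGen (Moves σ) p₀ p) (k : Fin F.numVars)
    (hk : 3 * (k : ℕ) + 3 ≤ F.index (σ.hom.place p)) :
    ∃ b p', Relation.ReflTransGen (Moves σ) p₀ p' ∧ σ.hom.place p' = .value k b := by
  induction h with
  | refl => simp [h₀, index] at hk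
  | @tail p p' h hm ih =>
    by_cases hlt : 3 * (k : ℕ) + 3 ≤ F.index (σ.hom.place p)
    · exact ih hlt
    obtain ⟨t, h₁, h₂⟩ := hm.exists_trans
    rw [h₂] at hk
    rw [h₁] at hlt
    rcases t with ⟨k', _ | _⟩ | ⟨k', b⟩ | ⟨i, j⟩ | ⟨i, j⟩
    · simp [source, target, index] at hk hlt; omega
    · simp [source, target, index] at hk hlt; omega
    · obtain rfl : k = k' := by
        ext
        cases b <;> simp [source, target, index] at hk hlt <;> omega
      exact ⟨b, p, h, h₁⟩
    · simp [source, target, index] at hk hlt; omega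
    · simp [source, target, index] at hk hlt; omega

/-- A player who gets beyond a clause has passed through one of its literals. -/
theorem exists_literal {q₀ q : σ.Place} (h₀ : σ.hom.place q₀ = .clauseStage 0)
    (h : Relation.ReflTransGen (Moves σ) q₀ q) (i : Fin F.clauses.length)
    (hi : 3 * F.numVars + 1 + 4 * (i : ℕ) + 4 ≤ F.index (σ.hom.place q)) :
    ∃ j q', Relation.ReflTransGen (Moves σ) q₀ q' ∧ σ.hom.place q' = .literal i j := by
  induction h with
  | refl => simp [h₀, index] at hi; omega
  | @tail q q' h hm ih =>
    by_cases hlt : 3 * F.numVars + 1 + 4 * (i : ℕ) + 4 ≤ F.index (σ.hom.place q)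
    · exact ih hlt
    obtain ⟨t, h₁, h₂⟩ := hm.exists_trans
    rw [h₂] at hi
    rw [h₁] at hlt
    rcases t with ⟨k', _ | _⟩ | ⟨k', _ | _⟩ | ⟨i', j⟩ | ⟨i', j⟩
    · simp [source, target, index] at hi hlt; omega
    · simp [source, target, index] at hi hlt; omega
    · simp [source, target, index] at hi hlt; omega
    · simp [source, target, index] at hi hlt; omega
    · simp [source, target, index] at hi hlt; omega
    · obtain rfl : i = i' := by
        ext
        simp [source, target, index] at hi hlt
        omega
      exact ⟨j, q, h, h₁⟩

/-- A winning strategy yields a satisfying assignment: deadlock avoidance forces both players to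
run to their last places, so they pass through a value of every variable and a literal of every
clause, and safety makes the literals true under the values. -/
theorem satisfiable_of_hasWinningStrategy (h : F.game.HasWinningStrategy) : F.Satisfiable := by
  classical
  obtain ⟨σ, hσ⟩ := h
  change BranchingProcess F.net at σ
  obtain ⟨p₀, q₀, hp₀, hq₀, hinit⟩ := exists_init_eq σ
  obtain ⟨p, hp, hp'⟩ := exists_stuck p₀
  obtain ⟨q, hq, hq'⟩ := exists_stuck q₀
  -- Nothing is enabled at the marking of two stuck places, so nothing is enabled in the game.
  have hstuck : ∀ t, σ.hom.place p ≠ F.source t ∧ σ.hom.place q ≠ F.source t := by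
    by_contra! hex
    obtain ⟨t, ht⟩ := hex
    obtain ⟨t', ht'⟩ := hσ.deadlock_avoiding {p, q} (reachable_pair hinit hp hq) ⟨t, by
      simp only [PetriNet.Enabled, game, net, Finset.singleton_val, Multiset.singleton_le,
        Multiset.insert_eq_cons, Multiset.map_cons, Multiset.map_singleton, Multiset.mem_cons,
        Multiset.mem_singleton]
      by_cases h : F.source t = σ.hom.place p
      · exact .inl h
      · exact .inr (ht (fun h' => h h'.symm)).symm⟩
    obtain ⟨r, hr, -⟩ := exists_pre_eq σ t'
    obtain ⟨r', hr', -⟩ := exists_post_eq σ t'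
    change (σ.net.pre t').val ≤ _ at ht'
    simp only [hr, Finset.singleton_val, Multiset.singleton_le, Multiset.insert_eq_cons,
      Multiset.mem_cons, Multiset.mem_singleton] at ht'
    rcases ht' with rfl | rfl
    · exact hp' r' ⟨t', hr, hr'⟩
    · exact hq' r' ⟨t', hr, hr'⟩
  have hpl : 3 * F.numVars ≤ F.index (σ.hom.place p) := by
    have h1 := isFirst_place hp
    rw [hp₀] at h1
    have h2 := fun t => (hstuck t).1
    generalize σ.hom.place p = x at h1 h2
    rcases x with k | ⟨k, b⟩ | i | ⟨i, j⟩
    · induction k using Fin.lastCases with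
      | last => simp [index]
      | cast k => exact absurd rfl (h2 (.choose k true))
    · exact absurd rfl (h2 (.advance k b))
    · simp [isFirst] at h1
    · simp [isFirst] at h1
  have hql : 3 * F.numVars + 1 + 4 * F.clauses.length ≤ F.index (σ.hom.place q) := by
    have h1 := isFirst_place hq
    rw [hq₀] at h1
    have h2 := fun t => (hstuck t).2
    generalize σ.hom.place q = x at h1 h2
    rcases x with k | ⟨k, b⟩ | i | ⟨i, j⟩
    · simp [isFirst] at h1
    · simp [isFirst] at h1
    · induction i using Fin.lastCases with
      | last => simp [index]
      | cast i => exact absurd rfl (h2 (.pick i 0))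
    · exact absurd rfl (h2 (.proceed i j))
  choose v pv hpv hv using fun k => exists_value hp₀ hp k (by omega)
  refine ⟨v, fun c hc => ?_⟩
  obtain ⟨i, rfl⟩ := List.mem_iff_get.1 hc
  obtain ⟨j, q', hq', hl⟩ := exists_literal hq₀ hq i (by omega)
  refine ⟨j, ?_⟩
  by_contra hne
  set k := (F.clauses.get i j).1 with hk
  refine hσ.safety _ (reachable_pair hinit (hpv k) hq') {.value k (v k), .literal i j}
    ⟨k, v k, i, j, Prod.ext hk.symm ?_, rfl⟩ ?_
  · revert hne
    generalize (F.clauses.get i j).2 = b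
    cases v k <;> cases b <;> simp
  · simp [hv, hl, Multiset.insert_eq_cons]

end Backward

section Forward

variable {F} (v : Fin F.numVars → Bool) (c : Fin F.clauses.length → Fin 3)

/-- The place is visited if the first player chooses the values `v` and the second player the
literals `c`. -/
def Visits : F.Place → Prop
  | .value k b => b = v k
  | .literal i j => j = c i
  | _ => True

/-- The transition is taken if the first player chooses the values `v` and the second player the
literals `c`. -/
def Takes : F.Trans → Prop
  | .choose k b => b = v k
  | .advance k b => b = v k
  | .pick i j => j = c i
  | .proceed i j => j = c i

variable {v c}

theorem Takes.visits_source {t : F.Trans} (h : Takes v c t) : Visits v c (F.source t) := by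
  cases t <;> first | exact h | trivial

theorem Takes.visits_target {t : F.Trans} (h : Takes v c t) : Visits v c (F.target t) := by
  cases t <;> first | exact h | trivial

/-- At most one transition that leaves a place is taken. -/
theorem Takes.eq_of_source_eq {t t' : F.Trans} (h : Takes v c t) (h' : Takes v c t')
    (he : F.source t = F.source t') : t = t' := by
  cases t <;> cases t' <;> simp_all [source, Takes]

theorem Takes.eq_of_target_eq {t t' : F.Trans} (h : Takes v c t) (h' : Takes v c t')
    (he : F.target t = F.target t') : t = t' := by
  cases t <;> cases t' <;> simp_all [target, Takes]

/-- A visited place is left unless it is the last place of its player. -/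
theorem exists_takes_of_visits_source {t : F.Trans} (h : Visits v c (F.source t)) :
    ∃ t', Takes v c t' ∧ F.source t' = F.source t := by
  rcases t with ⟨k, b⟩ | ⟨k, b⟩ | ⟨i, j⟩ | ⟨i, j⟩
  · exact ⟨.choose k (v k), rfl, rfl⟩
  · exact ⟨.advance k b, h, rfl⟩
  · exact ⟨.pick i (c i), rfl, rfl⟩
  · exact ⟨.proceed i j, h, rfl⟩

/-- A visited place is entered unless it is the first place of its player. -/
theorem exists_takes_of_visits {p : F.Place} (h : Visits v c p) (h₁ : p ≠ .stage 0)
    (h₂ : p ≠ .clauseStage 0) : ∃ t, Takes v c t ∧ F.target t = p := by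
  rcases p with k | ⟨k, b⟩ | i | ⟨i, j⟩
  · induction k using Fin.cases with
    | zero => exact absurd rfl h₁
    | succ k => exact ⟨.advance k (v k), rfl, rfl⟩
  · exact ⟨.choose k b, h, rfl⟩
  · induction i using Fin.cases with
    | zero => exact absurd rfl h₂
    | succ i => exact ⟨.proceed i (c i), rfl, rfl⟩
  · exact ⟨.pick i j, h, rfl⟩

theorem target_ne_init (t : F.Trans) : F.target t ≠ .stage 0 ∧ F.target t ≠ .clauseStage 0 := by
  cases t <;> simp [target, Fin.succ_ne_zero]

variable (v c)

/-- The subnet of the places visited and the transitions taken. -/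
def playNet : PetriNet {p : F.Place // Visits v c p} {t : F.Trans // Takes v c t} where
  pre t := {⟨F.source t, t.2.visits_source⟩}
  post t := {⟨F.target t, t.2.visits_target⟩}
  init := {⟨.stage 0, trivial⟩, ⟨.clauseStage 0, trivial⟩}
  pre_nonempty _ := Finset.singleton_nonempty _

variable {v c}

theorem mem_pre_playNet {t : {t : F.Trans // Takes v c t}} {p : {p : F.Place // Visits v c p}} :
    p ∈ (playNet v c).pre t ↔ p.1 = F.source t := by
  simp [playNet, Subtype.ext_iff]

theorem mem_post_playNet {t : {t : F.Trans // Takes v c t}} {p : {p : F.Place // Visits v c p}} :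
    p ∈ (playNet v c).post t ↔ p.1 = F.target t := by
  simp [playNet, Subtype.ext_iff]

variable (v c)

/-- The numbers of places increase along the flow relation. -/
theorem playNet_acyclic (x) : ¬ Relation.TransGen (playNet v c).Flow x x := by
  let w : {p : F.Place // Visits v c p} ⊕ {t : F.Trans // Takes v c t} → ℕ :=
    Sum.elim (fun p => 2 * F.index p) (fun t => 2 * F.index (F.source t) + 1)
  have hw : ∀ x y, (playNet v c).Flow x y → w x < w y := by
    rintro (p | t) (q | t') h
    · exact h.elim
    · have := mem_pre_playNet.1 h
      simp [w, this]
    · have := mem_post_playNet.1 h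
      have := F.index_source_lt_index_target t
      simp only [w, Sum.elim_inl, Sum.elim_inr, *]
      omega
    · exact h.elim
  have : ∀ x y, Relation.TransGen (playNet v c).Flow x y → w x < w y := by
    intro x y h
    induction h with
    | single h => exact hw _ _ h
    | tail _ h ih => exact ih.trans (hw _ _ h)
  exact fun h => lt_irrefl _ (this _ _ h)

theorem playNet_isOccurrenceNet : (playNet v c).IsOccurrenceNet where
  acyclic := playNet_acyclic v c
  finitely_preceded x := Set.toFinite _
  pre_place_unique p t t' h h' := Subtype.ext (t.2.eq_of_target_eq t'.2
    ((mem_post_playNet.1 h).symm.trans (mem_post_playNet.1 h')))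
  no_self_conflict := by
    rintro t ⟨t₁, t₂, hne, ⟨p, h₁, h₂⟩, -⟩
    exact hne (Subtype.ext (t₁.2.eq_of_source_eq t₂.2
      ((mem_pre_playNet.1 h₁).symm.trans (mem_pre_playNet.1 h₂))))
  mem_init_iff := by
    rintro ⟨p, hp⟩
    simp only [mem_post_playNet]
    constructor
    · intro h t ht
      have h' : p = .stage 0 ∨ p = .clauseStage 0 := by
        simpa [playNet, Subtype.ext_iff] using h
      have := target_ne_init t.1
      rw [← ht] at this
      exact h'.elim this.1 this.2
    · intro h
      by_contra hn
      obtain ⟨t, ht, rfl⟩ := exists_takes_of_visits hp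
        (fun he => hn (by simp [playNet, he])) (fun he => hn (by simp [playNet, he]))
      exact h ⟨t, ht⟩ rfl

/-- The branching process in which the players choose the values `v` and the literals `c`. -/
abbrev play : BranchingProcess F.net where
  Place := {p : F.Place // Visits v c p}
  Trans := {t : F.Trans // Takes v c t}
  net := playNet v c
  isOccurrenceNet := playNet_isOccurrenceNet v c
  hom :=
    { place := Subtype.val
      trans := Subtype.val
      bijOn_pre := fun t => by
        simp [playNet, net]
      bijOn_post := fun t => by
        simp [playNet, net]
      bijOn_init := by
        refine ⟨?_, Subtype.val_injective.injOn, ?_⟩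
        · rintro ⟨p, hp⟩ h
          simpa [playNet, net, Subtype.ext_iff] using h
        · intro p hp
          have hp' : p = .stage 0 ∨ p = .clauseStage 0 := by simpa [net] using hp
          rcases hp' with rfl | rfl
          · exact ⟨⟨.stage 0, trivial⟩, by simp [playNet], rfl⟩
          · exact ⟨⟨.clauseStage 0, trivial⟩, by simp [playNet], rfl⟩ }
  trans_unique _ _ _ h := Subtype.ext h

/-- If the chosen literals are true under the chosen values, the play never runs into a bad
marking; it refuses transitions only at system places, as all places are system places. -/
theorem isWinningStrategy_play
    (h : ∀ i, v (F.clauses.get i (c i)).1 = (F.clauses.get i (c i)).2) :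
    F.game.IsWinningStrategy (play v c) where
  justified_refusal := by
    intro C t _ ht hn
    -- A visited place is determined by its label, so `C` consists of a single place.
    change Subtype.val '' C = (({F.source t} : Finset F.Place) : Set F.Place) at ht
    have hC : ∀ q ∈ C, q.1 = F.source t := fun q hq => by
      simpa using ht.subset (Set.mem_image_of_mem _ hq)
    obtain ⟨p, hp, hpt⟩ := ht.symm.subset (show F.source t ∈ _ by simp)
    refine ⟨p, hp, trivial, fun t' ht' he => hn ⟨t', he, ?_⟩⟩
    ext q
    refine ⟨fun hq => ?_, fun hq => ?_⟩
    · have h₁ := mem_pre_playNet.1 hq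
      have h₂ := mem_pre_playNet.1 ht'
      rwa [Subtype.ext (h₁.trans h₂.symm)]
    · refine mem_pre_playNet.2 ?_
      rw [hC q hq]
      exact congrArg F.source he.symm
  safety := by
    rintro M - B ⟨k, b, i, j, hc, rfl⟩ hM
    have hval : ∀ p : F.Place, p ∈ ({.value k b, .literal i j} : Finset F.Place).val →
        Visits v c p := by
      intro p hp
      rw [← hM] at hp
      obtain ⟨q, -, rfl⟩ := Multiset.mem_map.1 hp
      exact q.2
    have h₁ : b = v k := hval (.value k b) (by simp)
    have h₂ : j = c i := hval (.literal i j) (by simp)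
    have := h i
    rw [← h₂, hc] at this
    simp [← h₁] at this
  determinism := by
    intro p _ M _ _ t t' h₁ h₂ _ _
    exact Subtype.ext (t.2.eq_of_source_eq t'.2
      ((mem_pre_playNet.1 h₁).symm.trans (mem_pre_playNet.1 h₂)))
  deadlock_avoiding := by
    rintro M - ⟨t, ht⟩
    have hs : F.source t ∈ M.map (play v c).hom.place :=
      Multiset.singleton_le.1 ht
    obtain ⟨⟨p, hv⟩, hp, rfl : p = F.source t⟩ := Multiset.mem_map.1 hs
    obtain ⟨t', ht', he⟩ := exists_takes_of_visits_source hv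
    refine ⟨⟨t', ht'⟩, ?_⟩
    change ({⟨F.source t', ht'.visits_source⟩} : Multiset {p : F.Place // Visits v c p}) ≤ M
    rw [Multiset.singleton_le]
    convert hp

end Forward

/-- A formula is satisfiable if and only if its Petri game has a winning strategy. -/
theorem satisfiable_iff_hasWinningStrategy : F.Satisfiable ↔ F.game.HasWinningStrategy := by
  refine ⟨?_, satisfiable_of_hasWinningStrategy⟩
  rintro ⟨v, hv⟩
  choose c hc using fun i => hv (F.clauses.get i) (List.get_mem _ _)
  exact ⟨play v c, isWinningStrategy_play v c hc⟩

/-! ### The Petri game of a formula as finite data -/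

/-- The number of places of the Petri game of the formula. -/
def numPlaces : ℕ :=
  3 * F.numVars + 1 + 4 * F.clauses.length + 1

theorem index_lt (p : F.Place) : F.index p < F.numPlaces := by
  rcases p with k | ⟨k, _ | _⟩ | i | ⟨i, j⟩ <;> simp [index, numPlaces] <;> omega

theorem index_injective : Function.Injective F.index := by
  rintro (k | ⟨k, _ | _⟩ | i | ⟨i, j⟩) (k' | ⟨k', _ | _⟩ | i' | ⟨i', j'⟩) h <;>
    simp [index, Fin.ext_iff] at h ⊢ <;> omega

theorem exists_index_eq {n : ℕ} (hn : n < F.numPlaces) : ∃ p, F.index p = n := by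
  unfold numPlaces at hn
  by_cases hm : n ≤ 3 * F.numVars
  · by_cases h0 : n % 3 = 0
    · exact ⟨.stage ⟨n / 3, by omega⟩, by simp [index]; omega⟩
    by_cases h1 : n % 3 = 1
    · exact ⟨.value ⟨n / 3, by omega⟩ true, by simp [index]; omega⟩
    · exact ⟨.value ⟨n / 3, by omega⟩ false, by simp [index]; omega⟩
  · by_cases h0 : (n - (3 * F.numVars + 1)) % 4 = 0
    · exact ⟨.clauseStage ⟨(n - (3 * F.numVars + 1)) / 4, by omega⟩, by simp [index]; omega⟩
    · exact ⟨.literal ⟨(n - (3 * F.numVars + 1)) / 4, by omega⟩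
        ⟨(n - (3 * F.numVars + 1)) % 4 - 1, by omega⟩, by simp [index]; omega⟩

/-- The numbering of the places. -/
noncomputable def placeEquiv : F.Place ≃ Fin F.numPlaces :=
  Equiv.ofBijective (fun p => ⟨F.index p, F.index_lt p⟩)
    ⟨fun _ _ h => F.index_injective (by simpa using h), fun n => by
      obtain ⟨p, hp⟩ := F.exists_index_eq n.2
      exact ⟨p, Fin.ext hp⟩⟩

theorem val_placeEquiv (p : F.Place) : (F.placeEquiv p : ℕ) = F.index p :=
  rfl

/-- All transitions, in the order in which the program lists them. -/
def transList : List F.Trans :=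
  (List.finRange F.numVars).flatMap (fun k =>
    [.choose k true, .choose k false, .advance k true, .advance k false]) ++
  (List.finRange F.clauses.length).flatMap (fun i =>
    [.pick i 0, .pick i 1, .pick i 2, .proceed i 0, .proceed i 1, .proceed i 2])

theorem mem_transList (t : F.Trans) : t ∈ F.transList := by
  rcases t with ⟨k, _ | _⟩ | ⟨k, _ | _⟩ | ⟨i, j⟩ | ⟨i, j⟩
  iterate 4 simp [transList]
  all_goals fin_cases j <;> simp [transList]

theorem nodup_transList : F.transList.Nodup := by
  refine List.Nodup.append ?_ ?_ ?_
  · refine List.nodup_flatMap.2 ⟨fun k _ => by simp, (List.nodup_finRange _).imp ?_⟩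
    intro k k' h
    simp [Function.onFun, List.disjoint_left, h]
  · refine List.nodup_flatMap.2 ⟨fun k _ => by simp, (List.nodup_finRange _).imp ?_⟩
    intro k k' h
    simp [Function.onFun, List.disjoint_left, h]
  · rw [List.disjoint_left]
    intro t h h'
    simp only [List.mem_flatMap, List.mem_cons, List.not_mem_nil] at h h'
    obtain ⟨k, -, h⟩ := h
    obtain ⟨i, -, h'⟩ := h'
    rcases h with rfl | rfl | rfl | rfl | h <;> simp_all

/-- The bad marking that involves the literal `j` of the clause `i`. -/
noncomputable def badPair (i : Fin F.clauses.length) (j : Fin 3) : List (Fin F.numPlaces) :=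
  [F.placeEquiv (.literal i j),
    F.placeEquiv (.value (F.clauses.get i j).1 !(F.clauses.get i j).2)]

/-- The Petri net of the formula with numbered places. -/
noncomputable abbrev netPresentation : NetPresentation where
  numPlaces := F.numPlaces
  transitions := F.transList.map fun t =>
    ([F.placeEquiv (F.source t)], [F.placeEquiv (F.target t)])
  init := [F.placeEquiv (.stage 0), F.placeEquiv (.clauseStage 0)]
  pre_ne_nil := by simp

/-- The numbering of the transitions. -/
noncomputable def transEquiv : F.Trans ≃ Fin F.netPresentation.transitions.length :=
  (F.nodup_transList.getEquivOfForallMemList _ F.mem_transList).symm.trans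
    (finCongr (by simp))

theorem get_transEquiv (t : F.Trans) : F.netPresentation.transitions.get (F.transEquiv t) =
    ([F.placeEquiv (F.source t)], [F.placeEquiv (F.target t)]) := by
  have h : F.transList[(F.transEquiv t : ℕ)]'(by simpa using (F.transEquiv t).2) = t :=
    (F.nodup_transList.getEquivOfForallMemList _ F.mem_transList).apply_symm_apply t
  simp [h]

theorem map_pre_placeEquiv (t : F.Trans) :
    (F.net.pre t).map F.placeEquiv.toEmbedding = F.netPresentation.net.pre (F.transEquiv t) := by
  change _ = (F.netPresentation.transitions.get (F.transEquiv t)).1.toFinset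
  rw [get_transEquiv]
  simp [net]

theorem map_post_placeEquiv (t : F.Trans) :
    (F.net.post t).map F.placeEquiv.toEmbedding = F.netPresentation.net.post (F.transEquiv t) := by
  change _ = (F.netPresentation.transitions.get (F.transEquiv t)).2.toFinset
  rw [get_transEquiv]
  simp [net]

theorem map_init_placeEquiv :
    F.net.init.map F.placeEquiv.toEmbedding = F.netPresentation.net.init := by
  ext p
  simp [net, NetPresentation.net, netPresentation]

/-- Every reachable marking of the numbered net is a renaming of a reachable marking. -/
theorem exists_reachable_of_netPresentation {M : Multiset (Fin F.numPlaces)}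
    (h : F.netPresentation.net.Reachable M) :
    ∃ M', F.net.Reachable M' ∧ M = M'.map F.placeEquiv := by
  refine ⟨M.map F.placeEquiv.symm, h.map F.placeEquiv.symm F.transEquiv.symm ?_ ?_ ?_, by simp⟩
  · intro t
    obtain ⟨t, rfl⟩ := F.transEquiv.surjective t
    rw [← map_pre_placeEquiv, Finset.map_map]
    simp
  · intro t
    obtain ⟨t, rfl⟩ := F.transEquiv.surjective t
    rw [← map_post_placeEquiv, Finset.map_map]
    simp
  · rw [← map_init_placeEquiv, Finset.map_map]
    simp

/-- The Petri game of the formula as finite data. -/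
noncomputable abbrev gamePresentation : GamePresentation where
  toNetPresentation := F.netPresentation
  safe M h := by
    obtain ⟨M', h', rfl⟩ := F.exists_reachable_of_netPresentation h
    exact (F.safe_net M' h').map F.placeEquiv.injective
  system := List.finRange F.numPlaces
  bad := (List.finRange F.clauses.length).reverse.flatMap fun i =>
    [F.badPair i 2, F.badPair i 1, F.badPair i 0]

theorem isKPlayer_gamePresentation : F.gamePresentation.game.IsKPlayer 2 := by
  intro M h
  obtain ⟨M', h', rfl⟩ := F.exists_reachable_of_netPresentation h
  obtain ⟨p, q, -, -, rfl⟩ := F.reachable_net h'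
  simp

theorem mem_bad_gamePresentation {l : List (Fin F.numPlaces)} :
    l ∈ F.gamePresentation.bad ↔ ∃ i j, l = F.badPair i j := by
  simp only [gamePresentation, List.mem_flatMap, List.mem_reverse, List.mem_finRange, true_and,
    List.mem_cons, List.not_mem_nil, or_false]
  refine exists_congr fun i => ⟨?_, ?_⟩
  · rintro (h | h | h)
    exacts [⟨2, h⟩, ⟨1, h⟩, ⟨0, h⟩]
  · rintro ⟨j, h⟩
    fin_cases j
    exacts [.inr (.inr h), .inr (.inl h), .inl h]

/-- The numbering is an isomorphism of Petri games. -/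
noncomputable def gameIso : F.game.Iso F.gamePresentation.game where
  place := F.placeEquiv
  trans := F.transEquiv
  map_pre := F.map_pre_placeEquiv
  map_post := F.map_post_placeEquiv
  map_init := F.map_init_placeEquiv
  system_iff p := by
    simp only [game, Set.mem_univ, true_iff]
    exact List.mem_finRange _
  bad_iff B := by
    change (∃ k b i j, _ ∧ _) ↔ ∃ l ∈ F.gamePresentation.bad, _ = l.toFinset
    constructor
    · rintro ⟨k, b, i, j, h, rfl⟩
      refine ⟨_, F.mem_bad_gamePresentation.2 ⟨i, j, rfl⟩, ?_⟩
      ext p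
      simp only [badPair, h, Bool.not_not]
      simp [or_comm]
    · rintro ⟨l, hl, h⟩
      obtain ⟨i, j, rfl⟩ := F.mem_bad_gamePresentation.1 hl
      refine ⟨_, !(F.clauses.get i j).2, i, j, by rw [Bool.not_not], ?_⟩
      refine Finset.map_injective F.placeEquiv.toEmbedding (h.trans ?_)
      ext p
      simp only [badPair]
      simp [or_comm]

/-- The reduction: the Petri game of a formula as an instance of the synthesis problem. -/
noncomputable def twoPlayerGame : TwoPlayerPetriGame :=
  ⟨F.gamePresentation, F.isKPlayer_gamePresentation⟩

end ThreeCNF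

/-! ### Structured programs on stacks and their compilation to Turing machines -/

/-- Structured programs that operate on finitely many stacks `k : K` with alphabets `Γ k`. -/
inductive StackProgram (K : Type) (Γ : K → Type) : Type
  | skip
  | push (k : K) (a : Γ k)
  | seq (p q : StackProgram K Γ)
  /-- pop the stack `k`; continue with `f a` if its top was `a`, and with `q` if it was empty -/
  | branch (k : K) (f : Γ k → StackProgram K Γ) (q : StackProgram K Γ)
  /-- as long as the stack `k` is nonempty, pop its top `a` and execute `f a` -/
  | loop (k : K) (f : Γ k → StackProgram K Γ)

namespace StackProgram

open Turing TM2 Function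

variable {K : Type} {Γ : K → Type}

/-- Control points of a program. The additional points of `branch` and `loop` are the places where
the stack is popped. -/
def Label : StackProgram K Γ → Type
  | skip => Unit
  | push _ _ => Unit
  | seq p q => Label p ⊕ Label q
  | branch _ f q => Option ((Σ a, Label (f a)) ⊕ Label q)
  | loop _ f => Option (Σ a, Label (f a))

/-- The control point where a program starts. -/
def entry : (p : StackProgram K Γ) → Label p
  | skip => ()
  | push _ _ => ()
  | seq p _ => .inl (entry p)
  | branch _ _ _ => none
  | loop _ _ => none

theorem finite_label [∀ k, Finite (Γ k)] (p : StackProgram K Γ) : Finite (Label p) := by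
  induction p with
  | skip => exact inferInstanceAs (Finite Unit)
  | push _ _ => exact inferInstanceAs (Finite Unit)
  | seq p q hp hq => exact inferInstanceAs (Finite (Label p ⊕ Label q))
  | branch k f q hf hq => exact inferInstanceAs (Finite (Option ((Σ a, Label (f a)) ⊕ Label q)))
  | loop k f hf => exact inferInstanceAs (Finite (Option (Σ a, Label (f a))))

variable [DecidableEq K]

/-- The statement of the compiled machine at a control point of `p`, where `e` embeds the control
points of `p` into those of the machine and `x` is the control point that follows `p`. The internal
state of the machine holds the symbols popped last. -/
def code {Λ : Type} : (p : StackProgram K Γ) → (e : Label p → Λ) → (x : Λ) → Label p →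
    Stmt Γ Λ (∀ k, Option (Γ k))
  | skip, _, x, _ => .goto fun _ => x
  | push k a, _, x, _ => .push k (fun _ => a) (.goto fun _ => x)
  | seq p q, e, _, .inl l => code p (fun l => e (.inl l)) (e (.inr (entry q))) l
  | seq _ q, e, x, .inr l => code q (fun l => e (.inr l)) x l
  | branch k f q, e, _, none => .pop k (fun v o => update v k o) (.goto fun v =>
      match v k with
      | none => e (some (.inr (entry q)))
      | some a => e (some (.inl ⟨a, entry (f a)⟩)))
  | branch _ f _, e, x, some (.inl ⟨a, l⟩) => code (f a) (fun l => e (some (.inl ⟨a, l⟩))) x l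
  | branch _ _ q, e, x, some (.inr l) => code q (fun l => e (some (.inr l))) x l
  | loop k f, e, x, none => .pop k (fun v o => update v k o) (.goto fun v =>
      match v k with
      | none => x
      | some a => e (some ⟨a, entry (f a)⟩))
  | loop _ f, e, _, some ⟨a, l⟩ => code (f a) (fun l => e (some ⟨a, l⟩)) (e none) l

/-- `Exec p S S' t`: started on the stacks `S`, the program `p` terminates with the stacks `S'`
after `t` steps. -/
inductive Exec : StackProgram K Γ → (∀ k, List (Γ k)) → (∀ k, List (Γ k)) → ℕ → Prop
  | skip (S) : Exec .skip S S 1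
  | push (k a S) : Exec (.push k a) S (update S k (a :: S k)) 1
  | seq {p q S S' S'' t t'} : Exec p S S' t → Exec q S' S'' t' → Exec (.seq p q) S S'' (t + t')
  | branch_nil {k f q S S' t} : S k = [] → Exec q S S' t → Exec (.branch k f q) S S' (1 + t)
  | branch_cons {k f q S a l S' t} : S k = a :: l → Exec (f a) (update S k l) S' t →
      Exec (.branch k f q) S S' (1 + t)
  | loop_nil {k f S} : S k = [] → Exec (.loop k f) S S 1
  | loop_cons {k f S a l S' S'' t t'} : S k = a :: l → Exec (f a) (update S k l) S' t →
      Exec (.loop k f) S' S'' t' → Exec (.loop k f) S S'' (1 + (t + t'))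

theorem iterate_add_eq {α : Type} {f : α → Option α} {a : α} {b c : Option α} {t t' : ℕ}
    (h : (flip bind f)^[t] (some a) = b) (h' : (flip bind f)^[t'] b = c) :
    (flip bind f)^[t + t'] (some a) = c := by
  rw [add_comm, iterate_add_apply, h, h']

theorem iterate_one_eq {α : Type} {f : α → Option α} {a : α} {b : Option α} (h : f a = b) :
    (flip bind f)^[1] (some a) = b :=
  h

/-- A machine that contains the code of a program executes the program step by step. -/
theorem Exec.iterate_step {p : StackProgram K Γ} {S S' : ∀ k, List (Γ k)} {t : ℕ}
    (h : Exec p S S' t) {Λ : Type} (m : Λ → Stmt Γ Λ (∀ k, Option (Γ k))) (e : Label p → Λ)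
    (x : Λ) (hm : ∀ l, m (e l) = code p e x l) (v : ∀ k, Option (Γ k)) :
    ∃ v', (flip bind (TM2.step m))^[t] (some ⟨some (e (entry p)), v, S⟩) =
      some ⟨some x, v', S'⟩ := by
  induction h generalizing x v with
  | skip S =>
    refine ⟨v, iterate_one_eq ?_⟩
    simp [hm, code]
  | push k a S =>
    refine ⟨v, iterate_one_eq ?_⟩
    simp [hm, code]
  | @seq p q S S' S'' t t' h h' ih ih' =>
    obtain ⟨v₁, h₁⟩ := ih (fun l => e (.inl l)) (e (.inr (entry q)))
      (fun l => hm (.inl l)) v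
    obtain ⟨v₂, h₂⟩ := ih' (fun l => e (.inr l)) x (fun l => hm (.inr l)) v₁
    exact ⟨v₂, iterate_add_eq h₁ h₂⟩
  | @branch_nil k f q S S' t hS h ih =>
    obtain ⟨v₁, h₁⟩ := ih (fun l => e (some (.inr l))) x (fun l => hm (some (.inr l)))
      (update v k none)
    refine ⟨v₁, iterate_add_eq (iterate_one_eq ?_) h₁⟩
    have hu : update S k [] = S := by rw [← hS, update_eq_self]
    have h₀ := hm none
    simp only [code] at h₀
    simp [h₀, entry, hS, hu]
  | @branch_cons k f q S a l S' t hS h ih =>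
    obtain ⟨v₁, h₁⟩ := ih (fun l => e (some (.inl ⟨a, l⟩))) x
      (fun l => hm (some (.inl ⟨a, l⟩))) (update v k (some a))
    refine ⟨v₁, iterate_add_eq (iterate_one_eq ?_) h₁⟩
    have h₀ := hm none
    simp only [code] at h₀
    simp [h₀, entry, hS]
  | @loop_nil k f S hS =>
    refine ⟨update v k none, iterate_one_eq ?_⟩
    have hu : update S k [] = S := by rw [← hS, update_eq_self]
    have h₀ := hm none
    simp only [code] at h₀
    simp [h₀, entry, hS, hu]
  | @loop_cons k f S a l S' S'' t t' hS h h' ih ih' =>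
    obtain ⟨v₁, h₁⟩ := ih (fun l => e (some ⟨a, l⟩)) (e none)
      (fun l => hm (some ⟨a, l⟩)) (update v k (some a))
    obtain ⟨v₂, h₂⟩ := ih' e x hm v₁
    refine ⟨v₂, iterate_add_eq (iterate_one_eq ?_) (iterate_add_eq h₁ h₂)⟩
    have h₀ := hm none
    simp only [code] at h₀
    simp [h₀, entry, hS]

/-- The Turing machine that executes a program: the additional label `none` clears the internal
state and halts. -/
noncomputable def machine [Fintype K] [∀ k, Fintype (Γ k)] (p : StackProgram K Γ) (k₀ k₁ : K) :
    FinTM2 where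
  K := K
  k₀ := k₀
  k₁ := k₁
  Γ := Γ
  Λ := Option (Label p)
  main := some (entry p)
  ΛFin := have := finite_label p; Fintype.ofFinite _
  σ := ∀ k, Option (Γ k)
  initialState := fun _ => none
  m
    | none => .load (fun _ _ => none) .halt
    | some l => code p some none l

theorem initList_eq (tm : FinTM2) (s : List (tm.Γ tm.k₀)) :
    initList tm s = ⟨some tm.main, tm.initialState, update (fun _ => []) tm.k₀ s⟩ := by
  unfold initList
  congr 1
  funext k
  by_cases hk : k = tm.k₀
  · subst hk
    simp
  · simp [hk]

theorem haltList_eq (tm : FinTM2) (s : List (tm.Γ tm.k₁)) :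
    haltList tm s = ⟨none, tm.initialState, update (fun _ => []) tm.k₁ s⟩ := by
  unfold haltList
  congr 1
  funext k
  by_cases hk : k = tm.k₁
  · subst hk
    simp
  · simp [hk]

/-- A function is computable in polynomial time if a structured program computes it with a
polynomial number of steps. All alphabets are required to be finite, although `FinTM2` asks this
only of the input alphabet. -/
theorem nonempty_tm2ComputableInPolyTime [Fintype K] [∀ k, Fintype (Γ k)] (p : StackProgram K Γ)
    (k₀ k₁ : K) {α β : Type} {ea : α → List (Γ k₀)} {eb : β → List (Γ k₁)} {f : α → β}
    (time : Polynomial ℕ)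
    (h : ∀ a, ∃ t ≤ time.eval (ea a).length,
      Exec p (update (fun _ => []) k₀ (ea a)) (update (fun _ => []) k₁ (eb (f a))) t) :
    Nonempty (TM2ComputableInPolyTime ea eb f) := by
  choose t ht h using h
  refine ⟨⟨⟨machine p k₀ k₁, Equiv.refl _, Equiv.refl _⟩, time + 1, fun a => ⟨⟨t a + 1, ?_⟩, ?_⟩⟩⟩
  · obtain ⟨v, hv⟩ := (h a).iterate_step (machine p k₀ k₁).m some none (fun l => rfl)
      (fun _ => none)
    have h₀ := (congrArg (initList (machine p k₀ k₁)) (List.map_id (ea a))).trans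
      (initList_eq (machine p k₀ k₁) (ea a))
    have h₁ := (congrArg (haltList (machine p k₀ k₁)) (List.map_id (eb (f a)))).trans
      (haltList_eq (machine p k₀ k₁) (eb (f a)))
    exact (congrArg (fun c => (flip bind (machine p k₀ k₁).step)^[t a + 1] (some c)) h₀).trans
      ((iterate_add_eq hv (iterate_one_eq rfl)).trans (congrArg some h₁.symm))
  · simpa using ht a

end StackProgram

/-! ### A program that writes the Petri game of a formula -/

namespace GameWriter

open Function StackProgram

/-- The stacks of the program: the input, the output, and counters in unary. -/
inductive Stack
  | inp | out
  /-- the index of the current variable, or a temporary copy of a counter -/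
  | tmp
  /-- the number of the current place -/
  | place
  /-- the number of variables -/
  | vars
  /-- the number of clauses read -/
  | clauses
  /-- the number of literals read of the current clause -/
  | phase
  /-- units removed from `place` -/
  | done
  /-- units removed from `vars` -/
  | saved
  deriving DecidableEq

instance : Fintype Stack :=
  ⟨{.inp, .out, .tmp, .place, .vars, .clauses, .phase, .done, .saved},
    fun x => by cases x <;> simp⟩

/-- The alphabets of the stacks. -/
abbrev Alphabet : Stack → Type
  | .inp => FormulaSymbol
  | .out => GameSymbol
  | _ => Unit

instance : ∀ k, Fintype (Alphabet k)
  | .inp => inferInstanceAs (Fintype FormulaSymbol)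
  | .out => inferInstanceAs (Fintype GameSymbol)
  | .tmp | .place | .vars | .clauses | .phase | .done | .saved => inferInstanceAs (Fintype Unit)

/-- Programs on these stacks. -/
abbrev Program := StackProgram Stack Alphabet

/-- The contents of the stacks, with the counters as numbers. -/
structure State where
  inp : List FormulaSymbol := []
  out : List GameSymbol := []
  tmp : ℕ := 0
  place : ℕ := 0
  vars : ℕ := 0
  clauses : ℕ := 0
  phase : ℕ := 0
  done : ℕ := 0
  saved : ℕ := 0

/-- The contents of the stacks. -/
def State.stacks (s : State) : ∀ k, List (Alphabet k)
  | .inp => s.inp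
  | .out => s.out
  | .tmp => List.replicate s.tmp ()
  | .place => List.replicate s.place ()
  | .vars => List.replicate s.vars ()
  | .clauses => List.replicate s.clauses ()
  | .phase => List.replicate s.phase ()
  | .done => List.replicate s.done ()
  | .saved => List.replicate s.saved ()

/-- The program takes the state `s` to the state `s'` in at most `T` steps. -/
def Runs (p : Program) (s s' : State) (T : ℕ) : Prop :=
  ∃ t ≤ T, Exec p s.stacks s'.stacks t

theorem Runs.mono {p : Program} {s s' : State} {T T' : ℕ} (h : Runs p s s' T) (hT : T ≤ T') :
    Runs p s s' T' :=
  let ⟨t, ht, he⟩ := h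
  ⟨t, ht.trans hT, he⟩

theorem Runs.congr {p : Program} {s s' s'' : State} {T : ℕ} (h : Runs p s s' T) (hs : s' = s'') :
    Runs p s s'' T :=
  hs ▸ h

theorem Runs.seq {p q : Program} {s s' s'' : State} {T T' : ℕ} (h : Runs p s s' T)
    (h' : Runs q s' s'' T') : Runs (.seq p q) s s'' (T + T') :=
  let ⟨_, ht, he⟩ := h
  let ⟨_, ht', he'⟩ := h'
  ⟨_, Nat.add_le_add ht ht', he.seq he'⟩

theorem runs_skip (s : State) : Runs .skip s s 1 :=
  ⟨1, le_rfl, .skip _⟩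

theorem runs_push {k : Stack} {a : Alphabet k} {s s' : State}
    (h : update s.stacks k (a :: s.stacks k) = s'.stacks) : Runs (.push k a) s s' 1 :=
  ⟨1, le_rfl, h ▸ .push k a _⟩

theorem runs_loop_nil {k : Stack} {f : Alphabet k → Program} {s : State} (h : s.stacks k = []) :
    Runs (.loop k f) s s 1 :=
  ⟨1, le_rfl, .loop_nil h⟩

theorem runs_loop_cons {k : Stack} {f : Alphabet k → Program} {a : Alphabet k}
    {s s₁ s' s'' : State} {T T' : ℕ} (h : s.stacks k = a :: s₁.stacks k)
    (hu : update s.stacks k (s₁.stacks k) = s₁.stacks) (h₁ : Runs (f a) s₁ s' T)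
    (h₂ : Runs (.loop k f) s' s'' T') : Runs (.loop k f) s s'' (1 + (T + T')) :=
  let ⟨_, ht, he⟩ := h₁
  let ⟨_, ht', he'⟩ := h₂
  ⟨_, by omega, .loop_cons h (hu ▸ he) he'⟩

theorem runs_branch_nil {k : Stack} {f : Alphabet k → Program} {q : Program}
    {s s' : State} {T : ℕ} (h : s.stacks k = []) (h₁ : Runs q s s' T) :
    Runs (.branch k f q) s s' (1 + T) :=
  let ⟨_, ht, he⟩ := h₁
  ⟨_, by omega, .branch_nil h he⟩

theorem runs_branch_cons {k : Stack} {f : Alphabet k → Program} {q : Program} {a : Alphabet k}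
    {s s₁ s' : State} {T : ℕ} (h : s.stacks k = a :: s₁.stacks k)
    (hu : update s.stacks k (s₁.stacks k) = s₁.stacks) (h₁ : Runs (f a) s₁ s' T) :
    Runs (.branch k f q) s s' (1 + T) :=
  let ⟨_, ht, he⟩ := h₁
  ⟨_, by omega, .branch_cons h (hu ▸ he)⟩

/-- The rule for loops over counters. The state `I i j` is the one with `i` iterations ahead and `j`
iterations done, and `I' i j` is the state after the next pop. -/
theorem runs_loop {k : Stack} {f : Alphabet k → Program} {a : Alphabet k} (I I' : ℕ → ℕ → State)
    {n T : ℕ} (hnil : (I 0 n).stacks k = [])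
    (hcons : ∀ i j, (I (i + 1) j).stacks k = a :: (I' i j).stacks k)
    (hu : ∀ i j, update (I (i + 1) j).stacks k ((I' i j).stacks k) = (I' i j).stacks)
    (hf : ∀ i j, i + j + 1 = n → Runs (f a) (I' i j) (I i (j + 1)) T) :
    Runs (.loop k f) (I n 0) (I 0 n) (n * (T + 1) + 1) := by
  have key : ∀ i j, i + j = n → Runs (.loop k f) (I i j) (I 0 n) (i * (T + 1) + 1) := by
    intro i
    induction i with
    | zero =>
      rintro j rfl
      rw [Nat.zero_add] at hnil ⊢
      exact (runs_loop_nil hnil).mono (by omega)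
    | succ i ih =>
      intro j h
      refine (runs_loop_cons (hcons i j) (hu i j) (hf i j (by omega))
        (ih (j + 1) (by omega))).mono ?_
      rw [Nat.add_mul]
      omega
  exact key n 0 rfl

theorem runs_push_out (a : GameSymbol) (s : State) :
    Runs (.push .out a) s { s with out := a :: s.out } 1 :=
  runs_push (by funext k; cases k <;> rfl)

theorem runs_push_tmp (s : State) : Runs (.push .tmp ()) s { s with tmp := s.tmp + 1 } 1 :=
  runs_push (by funext k; cases k <;> rfl)

theorem runs_push_place (s : State) : Runs (.push .place ()) s { s with place := s.place + 1 } 1 :=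
  runs_push (by funext k; cases k <;> rfl)

theorem runs_push_vars (s : State) : Runs (.push .vars ()) s { s with vars := s.vars + 1 } 1 :=
  runs_push (by funext k; cases k <;> rfl)

theorem runs_push_clauses (s : State) :
    Runs (.push .clauses ()) s { s with clauses := s.clauses + 1 } 1 :=
  runs_push (by funext k; cases k <;> rfl)

theorem runs_push_phase (s : State) : Runs (.push .phase ()) s { s with phase := s.phase + 1 } 1 :=
  runs_push (by funext k; cases k <;> rfl)

theorem runs_push_done (s : State) : Runs (.push .done ()) s { s with done := s.done + 1 } 1 :=
  runs_push (by funext k; cases k <;> rfl)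

theorem runs_push_saved (s : State) : Runs (.push .saved ()) s { s with saved := s.saved + 1 } 1 :=
  runs_push (by funext k; cases k <;> rfl)

/-- Write the word `w` in front of the output. -/
def emit : List GameSymbol → Program
  | [] => .skip
  | a :: w => .seq (emit w) (.push .out a)

theorem runs_emit (w : List GameSymbol) (s : State) :
    Runs (emit w) s { s with out := w ++ s.out } (w.length + 1) := by
  induction w with
  | nil => exact runs_skip s
  | cons a w ih => exact ih.seq (runs_push_out a _)

/-- Write the number `place` in unary in front of the output. -/
def copyPlace : Program :=
  .seq (.loop .place fun _ => .seq (.push .out .tick) (.push .tmp ()))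
    (.loop .tmp fun _ => .push .place ())

theorem runs_copyPlace (s : State) (h : s.tmp = 0) :
    Runs copyPlace s { s with out := List.replicate s.place .tick ++ s.out }
      (5 * s.place + 2) := by
  obtain ⟨i, o, t, p, v, c, ph, d, sv⟩ := s
  obtain rfl : t = 0 := h
  refine Runs.mono (Runs.seq
    (runs_loop (a := ())
      (fun i' j => ⟨i, List.replicate j .tick ++ o, j, i', v, c, ph, d, sv⟩)
      (fun i' j => ⟨i, List.replicate j .tick ++ o, j, i', v, c, ph, d, sv⟩)
      (n := p) rfl (fun _ _ => rfl) (fun _ _ => by funext k; cases k <;> rfl)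
      (fun _ _ _ => (runs_push_out _ _).seq (runs_push_tmp _)))
    (runs_loop (a := ())
      (fun i' j => ⟨i, List.replicate p .tick ++ o, i', j, v, c, ph, d, sv⟩)
      (fun i' j => ⟨i, List.replicate p .tick ++ o, i', j, v, c, ph, d, sv⟩)
      (n := p) rfl (fun _ _ => rfl) (fun _ _ => by funext k; cases k <;> rfl)
      (fun _ _ _ => runs_push_place _))) ?_
  change _ ≤ 5 * p + 2
  omega

/-- Increase the counter `place` by `n`. -/
def addPlace : ℕ → Program
  | 0 => .skip
  | n + 1 => .seq (addPlace n) (.push .place ())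

theorem runs_addPlace (n : ℕ) (s : State) :
    Runs (addPlace n) s { s with place := s.place + n } (n + 1) := by
  induction n with
  | zero => exact runs_skip s
  | succ n ih => exact ih.seq (runs_push_place _)

/-- Move `n` units from `place` to `done`. -/
def shiftPlace : ℕ → Program
  | 0 => .skip
  | n + 1 => .seq (.branch .place (fun _ => .push .done ()) .skip) (shiftPlace n)

theorem runs_shiftPlace (n p : ℕ) (s : State) (h : s.place = p + n) :
    Runs (shiftPlace n) s { s with place := p, done := s.done + n } (2 * n + 1) := by
  induction n generalizing s with
  | zero =>
    obtain ⟨i, o, t, p', v, c, ph, d, sv⟩ := s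
    obtain rfl : p' = p := h
    exact runs_skip _
  | succ n ih =>
    obtain ⟨i, o, t, p', v, c, ph, d, sv⟩ := s
    obtain rfl : p' = p + n + 1 := h
    refine Runs.mono (Runs.congr (Runs.seq
      (runs_branch_cons (a := ()) (s₁ := ⟨i, o, t, p + n, v, c, ph, d, sv⟩) rfl
        (by funext k; cases k <;> rfl) (runs_push_done _)) (ih _ rfl)) ?_) ?_
    · simp only [State.mk.injEq, true_and, and_true]
      omega
    · omega

/-! ### Transitions -/

/-- The description of the set whose only element is the place `n`. -/
def singletonWord (n : ℕ) : List GameSymbol :=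
  GamePresentation.encodeNumber n ++ [.endSet]

/-- Write the set whose only element is the place `place + c`. -/
def writeSingleton (c : ℕ) : Program :=
  .seq (emit [.endPlace, .endSet]) (.seq copyPlace (emit (List.replicate c .tick)))

theorem runs_writeSingleton (c : ℕ) (s : State) (h : s.tmp = 0) :
    Runs (writeSingleton c) s { s with out := singletonWord (s.place + c) ++ s.out }
      (5 * s.place + c + 6) := by
  refine Runs.mono (Runs.congr ((runs_emit _ _).seq ((runs_copyPlace _ (by exact h)).seq (runs_emit _ _))) ?_)
    ?_
  · simp only [singletonWord, GamePresentation.encodeNumber, add_comm s.place, List.replicate_add]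
    simp only [List.append_assoc, List.cons_append, List.nil_append]
  · simp
    omega

/-- The description of the transitions from `p + ab.1` to `p + ab.2` for the pairs `ab` in a
list. -/
def transitionsWord (p : ℕ) (l : List (ℕ × ℕ)) : List GameSymbol :=
  l.flatMap fun ab => singletonWord (p + ab.1) ++ singletonWord (p + ab.2)

/-- Write the transitions from `place + ab.1` to `place + ab.2` for the pairs `ab` in a list. -/
def writeTransitions : List (ℕ × ℕ) → Program
  | [] => .skip
  | ab :: l => .seq (writeTransitions l) (.seq (writeSingleton ab.2) (writeSingleton ab.1))

theorem runs_writeTransitions (l : List (ℕ × ℕ)) (hl : ∀ ab ∈ l, ab.1 ≤ 4 ∧ ab.2 ≤ 4) (s : State)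
    (h : s.tmp = 0) :
    Runs (writeTransitions l) s { s with out := transitionsWord s.place l ++ s.out }
      (l.length * (10 * s.place + 20) + 1) := by
  induction l with
  | nil => exact ((runs_skip s).congr (by simp [transitionsWord])).mono (by simp)
  | cons ab l ih =>
    have h₁ := hl ab (by simp)
    refine Runs.mono (Runs.congr ((ih fun ab' h' => hl ab' (by simp [h'])).seq
      ((runs_writeSingleton _ _ (by exact h)).seq (runs_writeSingleton _ _ (by exact h)))) ?_) ?_
    · simp [transitionsWord]
    · simp only [List.length_cons, Nat.add_mul]
      omega

/-- The transitions of a variable, relative to the place before it. -/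
def varBlock : List (ℕ × ℕ) :=
  [(0, 1), (0, 2), (1, 3), (2, 3)]

/-- The transitions of a clause, relative to the place before it. -/
def clauseBlock : List (ℕ × ℕ) :=
  [(0, 1), (0, 2), (0, 3), (1, 4), (2, 4), (3, 4)]

/-- Write the transitions of all clauses, the last clause first. -/
def writeClauseTransitions : Program :=
  .loop .clauses fun _ => .seq (shiftPlace 4) (writeTransitions clauseBlock)

theorem runs_writeClauseTransitions (i : List FormulaSymbol) (o : List GameSymbol)
    (p v n ph d sv : ℕ) :
    Runs writeClauseTransitions ⟨i, o, 0, p + 4 * n, v, n, ph, d, sv⟩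
      ⟨i, (List.range n).flatMap (fun k => transitionsWord (p + 4 * k) clauseBlock) ++ o,
        0, p, v, 0, ph, d + 4 * n, sv⟩
      (n * (60 * (p + 4 * n) + 131) + 1) := by
  refine Runs.mono (Runs.congr (runs_loop (a := ()) (n := n) (T := 60 * (p + 4 * n) + 130)
      (fun k j => ⟨i, (List.range' k j).flatMap
        (fun k => transitionsWord (p + 4 * k) clauseBlock) ++ o,
        0, p + 4 * k, v, k, ph, d + 4 * j, sv⟩)
      (fun k j => ⟨i, (List.range' (k + 1) j).flatMap
        (fun k => transitionsWord (p + 4 * k) clauseBlock) ++ o,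
        0, p + 4 * k + 4, v, k, ph, d + 4 * j, sv⟩)
      rfl (fun _ _ => rfl) (fun _ _ => by funext k; cases k <;> rfl)
      (fun k j hkj => ?_)) ?_) ?_
  · refine Runs.mono (Runs.congr ((runs_shiftPlace 4 (p + 4 * k) _ rfl).seq
      (runs_writeTransitions clauseBlock (by simp [clauseBlock]) _ rfl)) ?_) ?_
    · simp [List.range'_succ, Nat.mul_add, Nat.add_assoc]
    · simp [clauseBlock]
      omega
  · simp [List.range_eq_range']
  · exact le_rfl

/-- Write the transitions of all variables, the last variable first. -/
def writeVarTransitions : Program :=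
  .loop .vars fun _ => .seq (.push .saved ()) (.seq (shiftPlace 3) (writeTransitions varBlock))

theorem runs_writeVarTransitions (i : List FormulaSymbol) (o : List GameSymbol)
    (n c ph d : ℕ) :
    Runs writeVarTransitions ⟨i, o, 0, 3 * n, n, c, ph, d, 0⟩
      ⟨i, (List.range n).flatMap (fun k => transitionsWord (3 * k) varBlock) ++ o,
        0, 0, 0, c, ph, d + 3 * n, n⟩
      (n * (40 * (3 * n) + 91) + 1) := by
  refine Runs.mono (Runs.congr (runs_loop (a := ()) (n := n) (T := 40 * (3 * n) + 90)
      (fun k j => ⟨i, (List.range' k j).flatMap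
        (fun k => transitionsWord (3 * k) varBlock) ++ o,
        0, 3 * k, k, c, ph, d + 3 * j, j⟩)
      (fun k j => ⟨i, (List.range' (k + 1) j).flatMap
        (fun k => transitionsWord (3 * k) varBlock) ++ o,
        0, 3 * k + 3, k, c, ph, d + 3 * j, j⟩)
      rfl (fun _ _ => rfl) (fun _ _ => by funext k; cases k <;> rfl)
      (fun k j hkj => ?_)) ?_) ?_
  · refine Runs.mono (Runs.congr ((runs_push_saved _).seq ((runs_shiftPlace 3 (3 * k) _ rfl).seq
      (runs_writeTransitions varBlock (by simp [varBlock]) _ rfl))) ?_) ?_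
    · simp [List.range'_succ, Nat.mul_add, Nat.add_assoc]
    · simp [varBlock]
      omega
  · simp [List.range_eq_range']
  · exact le_rfl

/-! ### Number of places, initial marking and system places -/

/-- Write the numbers below `place`, the largest one first, and move `place` to `done`. -/
def writeNumbers : Program :=
  .loop .place fun _ => .seq (.push .done ()) (.seq (emit [.endPlace]) copyPlace)

theorem runs_writeNumbers (i : List FormulaSymbol) (o : List GameSymbol) (n v c ph sv : ℕ) :
    Runs writeNumbers ⟨i, o, 0, n, v, c, ph, 0, sv⟩
      ⟨i, (List.range n).flatMap GamePresentation.encodeNumber ++ o, 0, 0, v, c, ph, n, sv⟩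
      (n * (5 * n + 6) + 1) := by
  refine Runs.mono (Runs.congr (runs_loop (a := ()) (n := n) (T := 5 * n + 5)
      (fun k j => ⟨i, (List.range' k j).flatMap GamePresentation.encodeNumber ++ o,
        0, k, v, c, ph, j, sv⟩)
      (fun k j => ⟨i, (List.range' (k + 1) j).flatMap GamePresentation.encodeNumber ++ o,
        0, k, v, c, ph, j, sv⟩)
      rfl (fun _ _ => rfl) (fun _ _ => by funext k; cases k <;> rfl)
      (fun k j hkj => ?_)) ?_) ?_
  · refine Runs.mono (Runs.congr ((runs_push_done _).seq ((runs_emit _ _).seq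
      (runs_copyPlace _ rfl))) ?_) ?_
    · simp [List.range'_succ, GamePresentation.encodeNumber]
    · simp
      omega
  · simp [List.range_eq_range']
  · exact le_rfl

/-- Write everything that precedes the transitions, provided that `done` is the largest place and
`saved` is the number of variables. -/
def writeHeader : Program :=
  .seq (.loop .done fun _ => .push .place ()) <|
  .seq (.push .place ()) <|
  .seq (emit [.endSet]) <|
  .seq writeNumbers <|
  .seq (emit [.endPlace, .endSet]) <|
  .seq (.loop .saved fun _ => emit [.tick, .tick, .tick]) <|
  .seq (emit [.endPlace, .endPlace, .tick]) <|
  .loop .done fun _ => emit [.tick]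

theorem runs_loop_done_place (n m : ℕ) (o : List GameSymbol) :
    Runs (.loop .done fun _ => .push .place ()) { out := o, done := n, saved := m }
      { out := o, place := n, saved := m } (n * 2 + 1) :=
  runs_loop (a := ()) (n := n)
    (fun k j => ⟨[], o, 0, j, 0, 0, 0, k, m⟩) (fun k j => ⟨[], o, 0, j, 0, 0, 0, k, m⟩)
    rfl (fun _ _ => rfl) (fun _ _ => by funext k; cases k <;> rfl) (fun _ _ _ => runs_push_place _)

theorem runs_loop_saved_emit (n m : ℕ) (o : List GameSymbol) :
    Runs (.loop .saved fun _ => emit [.tick, .tick, .tick]) { out := o, done := n, saved := m }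
      { out := List.replicate (3 * m) .tick ++ o, done := n } (m * 5 + 1) :=
  runs_loop (a := ()) (n := m)
    (fun k j => ⟨[], List.replicate (3 * j) .tick ++ o, 0, 0, 0, 0, 0, n, k⟩)
    (fun k j => ⟨[], List.replicate (3 * j) .tick ++ o, 0, 0, 0, 0, 0, n, k⟩)
    rfl (fun _ _ => rfl) (fun _ _ => by funext k; cases k <;> rfl) (fun _ _ _ => runs_emit _ _)

theorem runs_loop_done_emit (n : ℕ) (o : List GameSymbol) :
    Runs (.loop .done fun _ => emit [.tick]) { out := o, done := n }
      { out := List.replicate n .tick ++ o } (n * 3 + 1) :=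
  runs_loop (a := ()) (n := n)
    (fun k j => ⟨[], List.replicate j .tick ++ o, 0, 0, 0, 0, 0, k, 0⟩)
    (fun k j => ⟨[], List.replicate j .tick ++ o, 0, 0, 0, 0, 0, k, 0⟩)
    rfl (fun _ _ => rfl) (fun _ _ => by funext k; cases k <;> rfl) (fun _ _ _ => runs_emit _ _)

theorem runs_writeHeader (o : List GameSymbol) (n m : ℕ) :
    Runs writeHeader { out := o, done := n, saved := m }
      { out := GamePresentation.encodeNumber (n + 1) ++ (GamePresentation.encodeNumber 0 ++
          (GamePresentation.encodeNumber (3 * m + 1) ++ (.endSet ::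
          ((List.range (n + 1)).flatMap GamePresentation.encodeNumber ++ (.endSet :: o))))) }
      (5 * (n + 1) * (n + 1) + 11 * (n + 1) + 5 * m + 20) := by
  refine Runs.mono (Runs.congr
    ((runs_loop_done_place n m o).seq <|
    (runs_push_place _).seq <|
    (runs_emit _ _).seq <|
    (runs_writeNumbers _ _ _ _ _ _ _).seq <|
    (runs_emit _ _).seq <|
    (runs_loop_saved_emit _ _ _).seq <|
    (runs_emit _ _).seq <|
    runs_loop_done_emit _ _) ?_) ?_
  · simp [GamePresentation.encodeNumber, List.replicate_succ]
  · simp only [List.length_cons, List.length_nil]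
    ring_nf
    omega

/-! ### Bad markings -/

/-- Count a literal. The counter `phase` runs through `0, 1, 2, 0, …`; when it returns to `0`, the
clause is complete, and `place` moves on to the stage after it. -/
def advancePhase : Program :=
  .branch .phase
    (fun _ => .branch .phase
      (fun _ => .seq (.push .place ()) (.push .clauses ()))
      (.seq (.push .phase ()) (.push .phase ())))
    (.push .phase ())

theorem runs_advancePhase_zero (i : List FormulaSymbol) (o : List GameSymbol)
    (t p v c d sv : ℕ) :
    Runs advancePhase ⟨i, o, t, p, v, c, 0, d, sv⟩ ⟨i, o, t, p, v, c, 1, d, sv⟩ 4 :=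
  (runs_branch_nil rfl (runs_push_phase _)).mono (by omega)

theorem runs_advancePhase_one (i : List FormulaSymbol) (o : List GameSymbol)
    (t p v c d sv : ℕ) :
    Runs advancePhase ⟨i, o, t, p, v, c, 1, d, sv⟩ ⟨i, o, t, p, v, c, 2, d, sv⟩ 4 :=
  (runs_branch_cons (a := ()) (s₁ := ⟨i, o, t, p, v, c, 0, d, sv⟩) rfl
    (by funext k; cases k <;> rfl)
    (runs_branch_nil rfl ((runs_push_phase _).seq (runs_push_phase _)))).mono (by omega)

theorem runs_advancePhase_two (i : List FormulaSymbol) (o : List GameSymbol)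
    (t p v c d sv : ℕ) :
    Runs advancePhase ⟨i, o, t, p, v, c, 2, d, sv⟩ ⟨i, o, t, p + 1, v, c + 1, 0, d, sv⟩ 4 :=
  (runs_branch_cons (a := ()) (s₁ := ⟨i, o, t, p, v, c, 1, d, sv⟩) rfl
    (by funext k; cases k <;> rfl)
    (runs_branch_cons (a := ()) (s₁ := ⟨i, o, t, p, v, c, 0, d, sv⟩) rfl
      (by funext k; cases k <;> rfl)
      ((runs_push_place _).seq (runs_push_clauses _)))).mono (by omega)

/-- The description of the bad marking of a literal, where `p + 1` is the place of the literal and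
`3 * k + c` is the place of the value that makes it false. -/
def badWord (p k c : ℕ) : List GameSymbol :=
  GamePresentation.encodeNumber (p + 1) ++ (GamePresentation.encodeNumber (3 * k + c) ++ [.endSet])

/-- Write the bad marking of a literal, where `tmp` is the index of its variable. -/
def writeBad (c : ℕ) : Program :=
  .seq (emit [.endPlace, .endSet]) <|
  .seq (.loop .tmp fun _ => emit [.tick, .tick, .tick]) <|
  .seq (emit (.endPlace :: List.replicate c .tick)) <|
  .seq copyPlace <|
  .seq (emit [.tick]) (.push .place ())

theorem runs_loop_tmp_emit (i : List FormulaSymbol) (o : List GameSymbol)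
    (k p v c ph d sv : ℕ) :
    Runs (.loop .tmp fun _ => emit [.tick, .tick, .tick]) ⟨i, o, k, p, v, c, ph, d, sv⟩
      ⟨i, List.replicate (3 * k) .tick ++ o, 0, p, v, c, ph, d, sv⟩ (k * 5 + 1) :=
  runs_loop (a := ()) (n := k)
    (fun k j => ⟨i, List.replicate (3 * j) .tick ++ o, k, p, v, c, ph, d, sv⟩)
    (fun k j => ⟨i, List.replicate (3 * j) .tick ++ o, k, p, v, c, ph, d, sv⟩)
    rfl (fun _ _ => rfl) (fun _ _ => by funext k; cases k <;> rfl) (fun _ _ _ => runs_emit _ _)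

theorem runs_writeBad (b : ℕ) (i : List FormulaSymbol) (o : List GameSymbol)
    (k p v c ph d sv : ℕ) :
    Runs (writeBad b) ⟨i, o, k, p, v, c, ph, d, sv⟩
      ⟨i, badWord p k b ++ o, 0, p + 1, v, c, ph, d, sv⟩ (5 * k + 5 * p + b + 11) := by
  refine Runs.mono (Runs.congr
    ((runs_emit _ _).seq <|
    (runs_loop_tmp_emit _ _ _ _ _ _ _ _ _).seq <|
    (runs_emit _ _).seq <|
    (runs_copyPlace _ rfl).seq <|
    (runs_emit _ _).seq (runs_push_place _)) ?_) ?_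
  · simp only [badWord, GamePresentation.encodeNumber, add_comm (3 * k) b, List.replicate_add,
      add_comm p 1]
    simp only [List.append_assoc, List.cons_append, List.nil_append, List.replicate_one]
  · simp only [List.length_cons, List.length_nil, List.length_replicate]
    omega

/-- Process a symbol of the formula. -/
def readSymbol : FormulaSymbol → Program
  | .tick => .push .tmp ()
  -- The ticks before this symbol stand for the variables; `place` becomes `3 * m + 1`.
  | .endVars => .seq (.loop .tmp fun _ => .seq (.push .vars ()) (addPlace 3)) (.push .place ())
  -- The variable `k` is false at the place `3 * k + 2` and true at the place `3 * k + 1`.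
  | .pos => .seq (writeBad 2) advancePhase
  | .neg => .seq (writeBad 1) advancePhase

/-- Reading the word `w` takes the state `s` to the state `s'` in at most `T` steps, whatever
follows the word. -/
def Reads (w : List FormulaSymbol) (s s' : State) (T : ℕ) : Prop :=
  ∀ (r : List FormulaSymbol) (s'' : State) (T' : ℕ),
    Runs (.loop .inp readSymbol) { s' with inp := r } s'' T' →
    Runs (.loop .inp readSymbol) { s with inp := w ++ r } s'' (T + T')

theorem Reads.append {w w' : List FormulaSymbol} {s s' s'' : State} {T T' : ℕ}
    (h : Reads w s s' T) (h' : Reads w' s' s'' T') : Reads (w ++ w') s s'' (T + T') := by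
  intro r s₃ T₃ h₃
  rw [List.append_assoc, Nat.add_assoc]
  exact h _ _ _ (h' _ _ _ h₃)

theorem Reads.mono {w : List FormulaSymbol} {s s' : State} {T T' : ℕ} (h : Reads w s s' T)
    (hT : T ≤ T') : Reads w s s' T' :=
  fun r s'' T₀ h₀ => (h r s'' T₀ h₀).mono (by omega)

theorem Reads.congr {w : List FormulaSymbol} {s s' s'' : State} {T : ℕ} (h : Reads w s s' T)
    (hs : s' = s'') : Reads w s s'' T :=
  hs ▸ h

theorem reads_nil (s : State) : Reads [] s s 0 :=
  fun _ _ _ h => h.mono (by omega)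

theorem reads_singleton {a : FormulaSymbol} {s s' : State} {T : ℕ}
    (h : ∀ r, Runs (readSymbol a) { s with inp := r } { s' with inp := r } T) :
    Reads [a] s s' (T + 1) := by
  intro r s'' T' h'
  exact (runs_loop_cons (a := a) (s₁ := { s with inp := r }) rfl
    (by funext k; cases k <;> rfl) (h r) h').mono (by omega)

theorem reads_replicate_tick (n : ℕ) (s : State) :
    Reads (List.replicate n .tick) s { s with tmp := s.tmp + n } (2 * n) := by
  induction n with
  | zero => exact reads_nil s
  | succ n ih =>
    rw [List.replicate_succ']
    exact ih.append (reads_singleton fun r => runs_push_tmp _)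

theorem reads_endVars (i : List FormulaSymbol) (o : List GameSymbol) (m c ph d sv : ℕ) :
    Reads [.endVars] ⟨i, o, m, 0, 0, c, ph, d, sv⟩ ⟨i, o, 0, 3 * m + 1, m, c, ph, d, sv⟩
      (6 * m + 3) := by
  refine (reads_singleton fun r => ?_).mono le_rfl
  exact ((runs_loop (a := ()) (n := m)
    (fun k j => ⟨r, o, k, 3 * j, j, c, ph, d, sv⟩)
    (fun k j => ⟨r, o, k, 3 * j, j, c, ph, d, sv⟩)
    rfl (fun _ _ => rfl) (fun _ _ => by funext k; cases k <;> rfl)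
    (fun _ _ _ => (runs_push_vars _).seq (runs_addPlace 3 _))).seq (runs_push_place _)).mono
      (by omega)

/-- The description of the bad marking of a literal, where `p + 1` is the place of the literal. -/
def literalWord {m : ℕ} (p : ℕ) (l : Fin m × Bool) : List GameSymbol :=
  badWord p l.1 (if l.2 then 2 else 1)

theorem reads_encodeLiteral {m : ℕ} (l : Fin m × Bool) (i : List FormulaSymbol)
    (o : List GameSymbol) (p v c ph d sv p' c' ph' : ℕ)
    (h : ∀ r, Runs advancePhase ⟨r, literalWord p l ++ o, 0, p + 1, v, c, ph, d, sv⟩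
      ⟨r, literalWord p l ++ o, 0, p', v, c', ph', d, sv⟩ 4) :
    Reads (ThreeCNF.encodeLiteral l) ⟨i, o, 0, p, v, c, ph, d, sv⟩
      ⟨i, literalWord p l ++ o, 0, p', v, c', ph', d, sv⟩ (7 * m + 5 * p + 18) := by
  obtain ⟨k, b⟩ := l
  refine ((reads_replicate_tick k _).append (reads_singleton (T := 5 * k + 5 * p + 17)
    fun r => ?_)).mono (by omega)
  rw [Nat.zero_add]
  cases b
  · exact ((runs_writeBad 1 _ _ _ _ _ _ _ _ _).seq (h r)).mono (by dsimp only; omega)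
  · exact ((runs_writeBad 2 _ _ _ _ _ _ _ _ _).seq (h r)).mono (by dsimp only; omega)

/-- The description of the bad markings of a clause, where `p` is the place before the clause. -/
def clauseWord {m : ℕ} (p : ℕ) (c : Fin 3 → Fin m × Bool) : List GameSymbol :=
  literalWord (p + 2) (c 2) ++ (literalWord (p + 1) (c 1) ++ literalWord p (c 0))

theorem reads_clause {m : ℕ} (cl : Fin 3 → Fin m × Bool) (i : List FormulaSymbol)
    (o : List GameSymbol) (p v c d sv : ℕ) :
    Reads (ThreeCNF.encodeLiteral (cl 0) ++ ThreeCNF.encodeLiteral (cl 1) ++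
        ThreeCNF.encodeLiteral (cl 2))
      ⟨i, o, 0, p, v, c, 0, d, sv⟩ ⟨i, clauseWord p cl ++ o, 0, p + 4, v, c + 1, 0, d, sv⟩
      (21 * m + 15 * p + 69) := by
  refine Reads.mono (Reads.congr
    (((reads_encodeLiteral _ _ _ _ _ _ _ _ _ _ _ _
      fun r => runs_advancePhase_zero _ _ _ _ _ _ _ _).append
    (reads_encodeLiteral _ _ _ _ _ _ _ _ _ _ _ _
      fun r => runs_advancePhase_one _ _ _ _ _ _ _ _)).append
    (reads_encodeLiteral _ _ _ _ _ _ _ _ _ _ _ _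
      fun r => runs_advancePhase_two _ _ _ _ _ _ _ _)) ?_) ?_
  · simp [clauseWord]
  · omega

/-- The description of the bad markings of a list of clauses, the last clause first. -/
def clausesWord {m : ℕ} : ℕ → List (Fin 3 → Fin m × Bool) → List GameSymbol
  | _, [] => []
  | p, c :: cs => clausesWord (p + 4) cs ++ clauseWord p c

theorem reads_clauses {m : ℕ} (cs : List (Fin 3 → Fin m × Bool)) (A : ℕ) (i : List FormulaSymbol)
    (o : List GameSymbol) (p v c d sv : ℕ) (hA : p + 4 * cs.length ≤ A) :
    Reads (cs.flatMap fun cl => ThreeCNF.encodeLiteral (cl 0) ++ ThreeCNF.encodeLiteral (cl 1) ++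
        ThreeCNF.encodeLiteral (cl 2))
      ⟨i, o, 0, p, v, c, 0, d, sv⟩
      ⟨i, clausesWord p cs ++ o, 0, p + 4 * cs.length, v, c + cs.length, 0, d, sv⟩
      (cs.length * (21 * m + 15 * A + 69)) := by
  induction cs generalizing o p c with
  | nil => exact (reads_nil _).mono (Nat.zero_le _)
  | cons cl cs ih =>
    simp only [List.length_cons] at hA
    refine Reads.mono (Reads.congr ((reads_clause cl i o p v c d sv).append
      (ih _ (p + 4) (c + 1) (by omega))) ?_) ?_
    · simp only [clausesWord, List.length_cons, List.append_assoc, State.mk.injEq, true_and,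
        and_true]
      omega
    · simp only [List.length_cons, Nat.add_mul]
      omega

/-! ### The whole program -/

/-- Write the Petri game of the formula on the input. As the output is written from its end, the
bad markings come first and the number of places comes last. -/
def gameWriter : Program :=
  .seq (emit [.endBlock]) <|
  .seq (.loop .inp readSymbol) <|
  .seq (emit [.endBlock]) <|
  .seq writeClauseTransitions <|
  -- Go from the first place of the second player to the last place of the first player.
  .seq (shiftPlace 1) <|
  .seq writeVarTransitions writeHeader

/-- The output of the program. -/
def gameWord (F : ThreeCNF) : List GameSymbol :=
  GamePresentation.encodeNumber F.numPlaces ++ (GamePresentation.encodeNumber 0 ++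
    (GamePresentation.encodeNumber (3 * F.numVars + 1) ++ (.endSet ::
    ((List.range F.numPlaces).flatMap GamePresentation.encodeNumber ++ (.endSet ::
    ((List.range F.numVars).flatMap (fun k => transitionsWord (3 * k) varBlock) ++
    ((List.range F.clauses.length).flatMap
      (fun i => transitionsWord (3 * F.numVars + 1 + 4 * i) clauseBlock) ++ (.endBlock ::
    (clausesWord (3 * F.numVars + 1) F.clauses ++ [.endBlock])))))))))

theorem runs_read (F : ThreeCNF) (o : List GameSymbol) :
    Runs (.loop .inp readSymbol) { inp := F.encode, out := o }
      { out := clausesWord (3 * F.numVars + 1) F.clauses ++ o, vars := F.numVars,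
        place := 3 * F.numVars + 1 + 4 * F.clauses.length, clauses := F.clauses.length }
      (8 * F.numVars + 4 +
        F.clauses.length * (21 * F.numVars + 15 * F.numPlaces + 69)) := by
  have h := (((reads_replicate_tick F.numVars { out := o }).congr
    (s'' := ⟨[], o, F.numVars, 0, 0, 0, 0, 0, 0⟩) (by simp)).append
    (reads_endVars [] o F.numVars 0 0 0 0)).append
    (reads_clauses F.clauses F.numPlaces [] o (3 * F.numVars + 1) F.numVars 0 0 0
      (by simp [ThreeCNF.numPlaces])) [] _ _ (runs_loop_nil rfl)
  rw [List.append_nil] at h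
  refine Runs.mono (Runs.congr h ?_) ?_
  · simp
  · omega

theorem runs_gameWriter (F : ThreeCNF) :
    Runs gameWriter { inp := F.encode } { out := gameWord F }
      (200 * (F.numPlaces + 1) * (F.numPlaces + 1)) := by
  have hm : 3 * F.numVars + 4 * F.clauses.length + 2 = F.numPlaces := by
    unfold ThreeCNF.numPlaces
    omega
  refine Runs.mono (Runs.congr
    ((runs_emit _ _).seq <|
    (runs_read F _).seq <|
    (runs_emit _ _).seq <|
    (runs_writeClauseTransitions _ _ _ _ _ _ _ _).seq <|
    (runs_shiftPlace 1 (3 * F.numVars) _ rfl).seq <|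
    (runs_writeVarTransitions _ _ _ _ _ _).seq <|
    runs_writeHeader _ _ _) ?_) ?_
  · have hd : 4 * F.clauses.length + 1 + 3 * F.numVars + 1 = F.numPlaces := by omega
    simp [gameWord, hd]
  · have h₁ : F.clauses.length * (21 * F.numVars + 15 * F.numPlaces + 69) ≤
        F.numPlaces * (36 * F.numPlaces + 69) := Nat.mul_le_mul (by omega) (by omega)
    have h₂ : F.clauses.length * (60 * (3 * F.numVars + 1 + 4 * F.clauses.length) + 131) ≤
        F.numPlaces * (60 * F.numPlaces + 131) := Nat.mul_le_mul (by omega) (by omega)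
    have h₃ : F.numVars * (40 * (3 * F.numVars) + 91) ≤
        F.numPlaces * (40 * F.numPlaces + 91) := Nat.mul_le_mul (by omega) (by omega)
    have hd : 0 + 4 * F.clauses.length + 1 + 3 * F.numVars + 1 = F.numPlaces := by omega
    simp only [List.length_cons, List.length_nil, hd]
    nlinarith

/-! ### The output describes the Petri game -/

theorem flatMap_finRange {α : Type} (n : ℕ) (g : ℕ → List α) :
    (List.finRange n).flatMap (fun k : Fin n => g k) = (List.range n).flatMap g := by
  rw [← List.map_coe_finRange_eq_range, List.flatMap_map]

theorem encodeSet_finRange (n : ℕ) : GamePresentation.encodeSet (List.finRange n) =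
    (List.range n).flatMap GamePresentation.encodeNumber ++ [.endSet] := by
  rw [GamePresentation.encodeSet, flatMap_finRange n GamePresentation.encodeNumber]

theorem flatMap_transitions (F : ThreeCNF) :
    F.netPresentation.transitions.flatMap
      (fun t => GamePresentation.encodeSet t.1 ++ GamePresentation.encodeSet t.2) =
    (List.range F.numVars).flatMap (fun k => transitionsWord (3 * k) varBlock) ++
    (List.range F.clauses.length).flatMap
      (fun i => transitionsWord (3 * F.numVars + 1 + 4 * i) clauseBlock) := by
  rw [← flatMap_finRange, ← flatMap_finRange]
  simp only [ThreeCNF.transList, List.flatMap_map, List.flatMap_append, List.flatMap_assoc]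
  congr 2 <;> funext k <;>
    simp [transitionsWord, varBlock, clauseBlock, singletonWord, GamePresentation.encodeSet,
      ThreeCNF.val_placeEquiv, ThreeCNF.source, ThreeCNF.target, ThreeCNF.index, Nat.mul_add,
      Nat.add_assoc]

theorem clausesWord_eq {m : ℕ} (cs : List (Fin 3 → Fin m × Bool)) (p : ℕ) :
    clausesWord p cs = (List.finRange cs.length).reverse.flatMap
      (fun i : Fin cs.length => clauseWord (p + 4 * i) (cs.get i)) := by
  induction cs generalizing p with
  | nil => rfl
  | cons c cs ih =>
    simp only [clausesWord, ih, List.length_cons, List.finRange_succ, List.reverse_cons,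
      List.flatMap_append, ← List.map_reverse, List.flatMap_map]
    simp [Nat.mul_add, Nat.add_assoc, Nat.add_comm 4]

theorem encodeSet_badPair (F : ThreeCNF) (i : Fin F.clauses.length) (j : Fin 3) :
    GamePresentation.encodeSet (F.badPair i j) =
      literalWord (3 * F.numVars + 1 + 4 * i + j) (F.clauses.get i j) := by
  unfold ThreeCNF.badPair literalWord badWord
  generalize F.clauses.get i j = l
  obtain ⟨k, _ | _⟩ := l <;>
    simp [GamePresentation.encodeSet, ThreeCNF.val_placeEquiv, ThreeCNF.index, Nat.add_assoc]

theorem encode_twoPlayerGame (F : ThreeCNF) : F.twoPlayerGame.encode = gameWord F := by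
  have hbad : F.gamePresentation.bad.flatMap GamePresentation.encodeSet =
      clausesWord (3 * F.numVars + 1) F.clauses := by
    rw [clausesWord_eq]
    simp only [List.flatMap_assoc]
    congr 1
    funext i
    simp [encodeSet_badPair, clauseWord]
  change GamePresentation.encodeNumber F.numPlaces ++
    GamePresentation.encodeSet F.netPresentation.init ++
    GamePresentation.encodeSet (List.finRange F.numPlaces) ++
    F.netPresentation.transitions.flatMap
      (fun t => GamePresentation.encodeSet t.1 ++ GamePresentation.encodeSet t.2) ++ [.endBlock] ++
    F.gamePresentation.bad.flatMap GamePresentation.encodeSet ++ [.endBlock] = _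
  rw [hbad, flatMap_transitions, encodeSet_finRange, gameWord]
  simp [GamePresentation.encodeSet, ThreeCNF.val_placeEquiv, ThreeCNF.index]

theorem numPlaces_le (F : ThreeCNF) : F.numPlaces ≤ 3 * F.encode.length := by
  obtain ⟨m, cs⟩ := F
  have key : ∀ cs : List (Fin 3 → Fin m × Bool), 3 * cs.length ≤ (cs.flatMap fun c =>
      ThreeCNF.encodeLiteral (c 0) ++ ThreeCNF.encodeLiteral (c 1) ++
        ThreeCNF.encodeLiteral (c 2)).length := by
    intro cs
    induction cs with
    | nil => simp
    | cons c cs ih =>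
      simp only [List.flatMap_cons, List.length_append, ThreeCNF.encodeLiteral, List.length_cons,
        List.length_nil] at ih ⊢
      omega
  have := key cs
  simp only [ThreeCNF.numPlaces, ThreeCNF.encode, List.length_append, List.length_replicate,
    List.length_cons, List.length_nil]
  omega

theorem stacks_inp (w : List FormulaSymbol) :
    State.stacks { inp := w } = update (β := fun k => List (Alphabet k)) (fun _ => []) .inp w := by
  funext k
  cases k <;> rfl

theorem stacks_out (w : List GameSymbol) :
    State.stacks { out := w } = update (β := fun k => List (Alphabet k)) (fun _ => []) .out w := by
  funext k
  cases k <;> rfl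

/-- The game of a formula is computed in polynomial time; the number of places is at most three
times the length of the input, and the number of steps is quadratic in the number of places. -/
theorem nonempty_tm2ComputableInPolyTime_twoPlayerGame :
    Nonempty (Turing.TM2ComputableInPolyTime ThreeCNF.encode TwoPlayerPetriGame.encode
      ThreeCNF.twoPlayerGame) := by
  refine nonempty_tm2ComputableInPolyTime gameWriter .inp .out
    (200 * (3 * Polynomial.X + 1) * (3 * Polynomial.X + 1)) fun F => ?_
  obtain ⟨t, ht, h⟩ := runs_gameWriter F
  rw [stacks_inp, stacks_out, ← encode_twoPlayerGame] at h
  refine ⟨t, ht.trans ?_, h⟩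
  have := numPlaces_le F
  simp only [Polynomial.eval_mul, Polynomial.eval_add, Polynomial.eval_ofNat, Polynomial.eval_X,
    Polynomial.eval_one]
  gcongr

end GameWriter

theorem mainTheorem3 :
    ∃ f : ThreeCNF → TwoPlayerPetriGame,
      IsPolyTimeReduction ThreeCNF.encode TwoPlayerPetriGame.encode
        ThreeSAT TwoPlayerSynthesis f ∧
      ∀ F : ThreeCNF, Nonempty ((f F).game.Iso F.game) :=
  ⟨ThreeCNF.twoPlayerGame,
    ⟨GameWriter.nonempty_tm2ComputableInPolyTime_twoPlayerGame, fun F =>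
      F.satisfiable_iff_hasWinningStrategy.trans F.gameIso.hasWinningStrategy_iff⟩,
    fun F => ⟨F.gameIso.symm⟩⟩
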